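/- **Setting.** A metric graph $\mathsf G$ is given by vertices, finitely many internal edges $e$ (each with two endpoints and a length $r(e)\in(0,\infty)$; loops and multiple edges are allowed) and finitely many rays (each with one endpoint and infinite length). It is the disjoint union of the intervals $[0,r(e)]$ and $[0,\infty)$ with ends attached to the same vertex identified. The degree of a vertex is the number of ends of edges and rays attached to it (a loop counts twice). Let $\mu$ be the measure on $\mathsf G$ that is Lebesgue measure on each edge and ray, and let $d$ be the geodesic distance, i.e. the infimum of the lengths of paths ($+\infty$ between different connected components, if $\mathsf G$ is not connected); $d$ is the intrinsic distance of the Dirichlet form $\mathcal E(f,f)=\int |f'|^2\,d\mu$ with standard (Kirchhoff) conditions at the vertices, that is, on functions that are continuous at the vertices. Let $W$ be the quadratic ($L^2$-) Wasserstein distance of $(\mathsf G,d)$. For $A,B\subset\mathsf G$ and $t\in[0,1]$ put $$[A,B]_t=\{z\in\mathsf G:\ \exists x\in A,\ y\in B,\ d(x,z)=(1-t)\,d(x,y),\ d(z,y)=t\,d(x,y)\}.$$ For $K\in\mathbb R$, the Brunn–Minkowski inequality with parameter $K$ for $A,B,t$ is $$\log\mu([A,B]_t)\ \ge\ t\log\mu(A)+(1-t)\log\mu(B)+\frac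 K2\,t(1-t)\,W\!\left(\frac{1_A}{\mu(A)}\mu,\frac{1_B}{\mu(B)}\mu\right)^2 .$$ $CD(K,\infty)$ is the condition that any two probability measures $\nu_0,\nu_1$ on $\mathsf G$ with finite second moments, relative entropies $\mathrm{Ent}(\nu_i|\mu)<\infty$ and $W(\nu_0,\nu_1)<\infty$ are joined by a constant speed $W$-geodesic $(\nu_t)_{t\in[0,1]}$ of measures with finite second moments and $\mathrm{Ent}(\nu_t|\mu)<\infty$ such that $\mathrm{Ent}(\nu_t|\mu)\le(1-t)\,\mathrm{Ent}(\nu_0|\mu)+t\,\mathrm{Ent}(\nu_1|\mu)-\frac K2t(1-t)W(\nu_0,\nu_1)^2$ for all $t\in[0,1]$. **Theorem.** Let $\mathsf G$ be a metric graph (with standard vertex conditions) that has at least one vertex of degree greater than $2$. Then for every $K\in\mathbb R$: 1. there are Borel sets $A,B\subset\mathsf G$ with $0<\mu(A),\mu(B)<\infty$ and $A\cup B$ of finite diameter, and a $t\in(0,1)$, for which the Brunn–Minkowski inequality with parameter $K$ fails; 2. $(\mathsf G,d,\mu)$ does not satisfy $CD(K,\infty)$. -/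

import Mathlib

open Set MeasureTheory
open scoped ENNReal

noncomputable section

/-! ### Optimal transport and entropy on a metric measure space -/

section MetricMeasure

variable {X : Type*} [PseudoEMetricSpace X] [MeasurableSpace X]

/-- `π` is a coupling (transport plan) of `ν₀` and `ν₁`. -/
def IsCoupling (ν₀ ν₁ : Measure X) (π : Measure (X × X)) : Prop :=
  π.map Prod.fst = ν₀ ∧ π.map Prod.snd = ν₁

/-- The quadratic Wasserstein distance
`W(ν₀, ν₁) = (inf_π ∫ d(x, y)² dπ(x, y))^(1/2)`, the infimum over all couplings. -/
def wasserstein (ν₀ ν₁ : Measure X) : ℝ≥0∞ :=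
  (⨅ (π : Measure (X × X)) (_ : IsCoupling ν₀ ν₁ π), ∫⁻ p, edist p.1 p.2 ^ 2 ∂π) ^ (1 / 2 : ℝ)

/-- `ν` belongs to `P₂(X)`: it is a probability measure with finite second moment. -/
def MemP2 (ν : Measure X) : Prop :=
  IsProbabilityMeasure ν ∧ ∃ x₀ : X, ∫⁻ x, edist x x₀ ^ 2 ∂ν < ∞

/-- The relative entropy `Ent(ν | μ) = ∫ ρ log ρ dμ` when `ν = ρ μ`, and `+∞` when `ν` is not
absolutely continuous. The integral is the difference of the integrals of the positive and of the
negative part, and it is `+∞` as soon as the positive part is not integrable; this is the limit of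
`∫_{ρ > ε} ρ log ρ dμ` as `ε ↓ 0`. -/
def relEntropy (ν μ : Measure X) : EReal :=
  let h : X → ℝ := fun x => (ν.rnDeriv μ x).toReal * Real.log (ν.rnDeriv μ x).toReal
  open Classical in
  if ν ≪ μ ∧ ∫⁻ x, ENNReal.ofReal (h x) ∂μ ≠ ∞ then
    ((∫⁻ x, ENNReal.ofReal (h x) ∂μ : ℝ≥0∞) : EReal)
      - ((∫⁻ x, ENNReal.ofReal (-h x) ∂μ : ℝ≥0∞) : EReal)
  else ⊤

/-- `Γ`, restricted to `[0, 1]`, is a constant speed `W`-geodesic from `ν₀` to `ν₁`. -/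
def IsWassersteinGeodesic (ν₀ ν₁ : Measure X) (Γ : ℝ → Measure X) : Prop :=
  Γ 0 = ν₀ ∧ Γ 1 = ν₁ ∧
    ∀ s ∈ Icc (0 : ℝ) 1, ∀ t ∈ Icc (0 : ℝ) 1,
      wasserstein (Γ s) (Γ t) = ENNReal.ofReal |s - t| * wasserstein ν₀ ν₁

/-- The curvature-dimension condition `CD(K, ∞)` of Sturm and Lott--Villani: any two measures in
`P₂(X)` of finite entropy are joined by a geodesic of `P₂(X)` consisting of measures of finite
entropy, along which the entropy is `K`-convex. (`W(ν₀, ν₁) < ∞` is automatic when the distance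
is finite.) -/
def CDInfty (μ : Measure X) (K : ℝ) : Prop :=
  ∀ ν₀ ν₁ : Measure X, MemP2 ν₀ → MemP2 ν₁ → relEntropy ν₀ μ < ⊤ → relEntropy ν₁ μ < ⊤ →
    wasserstein ν₀ ν₁ < ∞ →
    ∃ Γ : ℝ → Measure X, IsWassersteinGeodesic ν₀ ν₁ Γ ∧
      ∀ t ∈ Icc (0 : ℝ) 1, MemP2 (Γ t) ∧ relEntropy (Γ t) μ < ⊤ ∧
        relEntropy (Γ t) μ ≤
          ((1 - t : ℝ) : EReal) * relEntropy ν₀ μ + (t : EReal) * relEntropy ν₁ μ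
            - ((K / 2 * t * (1 - t) : ℝ) : EReal) * ((wasserstein ν₀ ν₁ ^ 2 : ℝ≥0∞) : EReal)

/-- `[A, B]_t`, the set of the points that lie on a geodesic from a point `x` of `A` (weight `t`)
to a point `y` of `B` (weight `1 - t`), at distance `(1 - t) d(x, y)` from `x` and `t d(x, y)`
from `y`. -/
def intermediateSet (A B : Set X) (t : ℝ) : Set X :=
  {z | ∃ x ∈ A, ∃ y ∈ B, edist x z = ENNReal.ofReal (1 - t) * edist x y ∧
    edist z y = ENNReal.ofReal t * edist x y}

/-- The Brunn--Minkowski inequality with curvature parameter `K` for the sets `A`, `B` and the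
time `t`:
`log μ([A,B]_t) ≥ t log μ(A) + (1-t) log μ(B) + (K/2) t (1-t) W(1_A μ / μ(A), 1_B μ / μ(B))²`. -/
def BrunnMinkowski (μ : Measure X) (K : ℝ) (A B : Set X) (t : ℝ) : Prop :=
  (t : EReal) * ENNReal.log (μ A) + ((1 - t : ℝ) : EReal) * ENNReal.log (μ B)
      + ((K / 2 * t * (1 - t) : ℝ) : EReal) *
        ((wasserstein ((μ A)⁻¹ • μ.restrict A) ((μ B)⁻¹ • μ.restrict B) ^ 2 : ℝ≥0∞) : EReal)
    ≤ ENNReal.log (μ (intermediateSet A B t))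

end MetricMeasure

/-! ### Metric graphs -/

/-- The combinatorial data of a metric graph with vertices `V`, internal edges `E` and rays `R`.
An internal edge has two endpoints (possibly equal) and a finite length, a ray has one endpoint and
infinite length. Multiple edges are allowed. -/
structure MetricGraph (V E R : Type*) where
  source : E → V
  target : E → V
  length : E → ℝ
  length_pos : ∀ e, 0 < length e
  root : R → V

namespace MetricGraph

variable {V E R : Type*} (G : MetricGraph V E R)

/-- The degree of a vertex: the number of ends of edges and rays at it (a loop counts twice). -/
def degree (v : V) : ℕ :=
  Nat.card {e // G.source e = v} + Nat.card {e // G.target e = v} + Nat.card {r // G.root r = v}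

/-- The parameter interval: `[0, length e]` for an internal edge `e`, `[0, ∞)` for a ray. -/
def interval : E ⊕ R → Set ℝ
  | .inl e => Icc 0 (G.length e)
  | .inr _ => Ici 0

/-- The parameter `s` of the edge or ray `a` is an end that is attached to the vertex `v`. -/
def IsEnd : E ⊕ R → ℝ → V → Prop
  | .inl e, s, v => (s = 0 ∧ G.source e = v) ∨ (s = G.length e ∧ G.target e = v)
  | .inr r, s, v => s = 0 ∧ G.root r = v

theorem IsEnd.unique {a : E ⊕ R} {s : ℝ} {v w : V} (hv : G.IsEnd a s v) (hw : G.IsEnd a s w) :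
    v = w := by
  rcases a with e | r
  · have := G.length_pos e
    rcases hv with ⟨h1, rfl⟩ | ⟨h1, rfl⟩ <;> rcases hw with ⟨h2, rfl⟩ | ⟨h2, rfl⟩ <;>
      first | rfl | (exfalso; linarith)
  · exact hv.2.symm.trans hw.2

/-- The gluing of the ends of the intervals that are attached to the same vertex. -/
def gluing : Setoid (Σ a : E ⊕ R, G.interval a) where
  r p q := p = q ∨ ∃ v, G.IsEnd p.1 p.2 v ∧ G.IsEnd q.1 q.2 v
  iseqv :=
    { refl := fun _ => Or.inl rfl
      symm := by
        rintro p q (rfl | ⟨v, hp, hq⟩)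
        · exact Or.inl rfl
        · exact Or.inr ⟨v, hq, hp⟩
      trans := by
        rintro p q r (rfl | ⟨v, hp, hq⟩) (rfl | ⟨w, hq', hr⟩)
        · exact Or.inl rfl
        · exact Or.inr ⟨w, hq', hr⟩
        · exact Or.inr ⟨v, hp, hq⟩
        · obtain rfl := hq.unique G hq'
          exact Or.inr ⟨v, hp, hr⟩ }

/-- The underlying space of the metric graph: the disjoint union of the intervals of all edges and
rays, with the ends that are attached to the same vertex identified. -/
def Point : Type _ := Quotient G.gluing

/-- The canonical map of the interval of an edge or ray into the metric graph. -/
def proj (a : E ⊕ R) (s : G.interval a) : G.Point := Quotient.mk G.gluing ⟨a, s⟩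

/-- `G.IsPath x y ℓ`: there is a path from `x` to `y` of length `ℓ`, made of finitely many segments
each of which lies on a single edge or ray. -/
inductive IsPath : G.Point → G.Point → ℝ → Prop
  | nil (x : G.Point) : IsPath x x 0
  | cons (a : E ⊕ R) (s s' : G.interval a) (y : G.Point) (l : ℝ) :
      IsPath (G.proj a s') y l → IsPath (G.proj a s) y (|(s : ℝ) - s'| + l)

theorem IsPath.trans {x y z : G.Point} {l m : ℝ} (h : G.IsPath x y l) (h' : G.IsPath y z m) :
    G.IsPath x z (l + m) := by
  induction h with
  | nil x => simpa using h'
  | cons a s s' y l _ ih => rw [add_assoc]; exact .cons a s s' z _ (ih h')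

theorem IsPath.single (a : E ⊕ R) (s s' : G.interval a) :
    G.IsPath (G.proj a s) (G.proj a s') |(s : ℝ) - s'| := by
  simpa using IsPath.cons a s s' _ 0 (.nil _)

theorem IsPath.symm {x y : G.Point} {l : ℝ} (h : G.IsPath x y l) : G.IsPath y x l := by
  induction h with
  | nil x => exact .nil x
  | cons a s s' y l _ ih =>
    rw [add_comm, abs_sub_comm]
    exact ih.trans G (.single G a s' s)

theorem IsPath.nonneg {x y : G.Point} {l : ℝ} (h : G.IsPath x y l) : 0 ≤ l := by
  induction h with
  | nil x => exact le_rfl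
  | cons a s s' y l _ ih => positivity

/-- The intrinsic (geodesic) distance: the infimum of the lengths of the paths from `x` to `y`
(`∞` if there is none, that is, if `x` and `y` lie in different connected components). -/
def geodesicDist (x y : G.Point) : ℝ≥0∞ :=
  ⨅ (l : ℝ) (_ : G.IsPath x y l), ENNReal.ofReal l

instance : PseudoEMetricSpace G.Point where
  edist := G.geodesicDist
  edist_self x := le_antisymm (iInf₂_le_of_le 0 (.nil x) (by simp)) bot_le
  edist_comm x y := by
    apply le_antisymm <;>
      exact le_iInf₂ fun l h => iInf₂_le_of_le l (h.symm G) le_rfl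
  edist_triangle x y z := by
    simp only [geodesicDist, ENNReal.iInf_add, ENNReal.add_iInf]
    exact le_iInf₂ fun m h => le_iInf₂ fun l h' =>
      iInf₂_le_of_le (l + m) (h'.trans G h) ENNReal.ofReal_add_le

/-- The Borel sets of the geodesic distance. -/
instance : MeasurableSpace G.Point := borel G.Point

instance : BorelSpace G.Point := ⟨rfl⟩

/-- The reference measure: Lebesgue measure on each edge and ray. -/
def measure : Measure G.Point :=
  Measure.sum fun a : E ⊕ R => ((volume : Measure ℝ).comap Subtype.val).map (G.proj a)

theorem edist_proj_le (a : E ⊕ R) (s s' : G.interval a) :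
    edist (G.proj a s) (G.proj a s') ≤ edist s s' := by
  refine (iInf₂_le_of_le _ (.single G a s s') le_rfl).trans_eq ?_
  rw [Subtype.edist_eq, edist_dist, Real.dist_eq]

theorem measurable_proj (a : E ⊕ R) : Measurable (G.proj a) :=
  (LipschitzWith.of_edist_le (G.edist_proj_le a)).continuous.measurable

/-- The geodesic distance is the intrinsic distance of the Dirichlet form with standard boundary
conditions, the supremum of `|f x - f y|` over the functions `f` on the metric graph (that is,
functions on the edges whose values at each vertex agree) with `|f'| ≤ 1` on each edge and ray. -/
theorem edist_eq_iSup (x y : G.Point) :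
    edist x y = ⨆ (f : G.Point → ℝ)
      (_ : ∀ (a : E ⊕ R) (s s' : G.interval a),
        |f (G.proj a s) - f (G.proj a s')| ≤ |(s : ℝ) - s'|), ENNReal.ofReal |f x - f y| := by
  apply le_antisymm
  · refine le_of_forall_lt fun c hc => ?_
    have key : ∀ n : ℕ, min (edist x y) n ≤ ⨆ (f : G.Point → ℝ)
      (_ : ∀ (a : E ⊕ R) (s s' : G.interval a),
        |f (G.proj a s) - f (G.proj a s')| ≤ |(s : ℝ) - s'|), ENNReal.ofReal |f x - f y| := by
      intro n
      have fin : ∀ z, min (edist x z) n ≠ ∞ := fun z =>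
        ne_top_of_le_ne_top (ENNReal.natCast_ne_top n) (min_le_right _ _)
      have half : ∀ (a : E ⊕ R) (s s' : G.interval a),
          (min (edist x (G.proj a s)) n).toReal ≤
            (min (edist x (G.proj a s')) n).toReal + |(s : ℝ) - s'| := by
        intro a s s'
        have h1 : edist (G.proj a s') (G.proj a s) ≤ ENNReal.ofReal |(s : ℝ) - s'| := by
          rw [edist_comm]
          refine (G.edist_proj_le a s s').trans_eq ?_
          rw [Subtype.edist_eq, edist_dist, Real.dist_eq]
        have h2 : min (edist x (G.proj a s)) n ≤
            min (edist x (G.proj a s')) n + ENNReal.ofReal |(s : ℝ) - s'| := by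
          rw [min_add]
          refine le_min ?_ ?_
          · exact (min_le_left _ _).trans ((edist_triangle _ _ _).trans (by gcongr))
          · exact (min_le_right _ _).trans le_self_add
        have h3 := ENNReal.toReal_mono (ENNReal.add_ne_top.2 ⟨fin _, ENNReal.ofReal_ne_top⟩) h2
        rwa [ENNReal.toReal_add (fin _) ENNReal.ofReal_ne_top,
          ENNReal.toReal_ofReal (abs_nonneg _)] at h3
      refine le_iSup₂_of_le (fun z => (min (edist x z) n).toReal) ?_ ?_
      · intro a s s'
        rw [abs_le]
        have := half a s s'
        have h' := half a s' s
        rw [abs_sub_comm] at h'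
        constructor <;> linarith
      · simp only [edist_self, zero_le, min_eq_left, ENNReal.toReal_zero, zero_sub, abs_neg,
          abs_of_nonneg ENNReal.toReal_nonneg]
        rw [ENNReal.ofReal_toReal (fin y)]
    obtain ⟨n, hn⟩ := ENNReal.exists_nat_gt hc.ne_top
    exact (lt_min hc hn).trans_le (key n)
  · refine iSup₂_le fun f hf => le_iInf₂ fun l h => ENNReal.ofReal_le_ofReal ?_
    induction h with
    | nil x => simp
    | cons a s s' y l _ ih =>
      exact (abs_sub_le _ _ _).trans (add_le_add (hf a s s') ih)

end MetricGraph

end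

/-! ### Couplings and integrals of real functions -/

section Coupling

variable {X : Type*} [MeasurableSpace X] {f : X → ℝ}

/-! The obstruction is branching. At a vertex with three legs, spread mass uniformly over a segment
of length `ε` on one leg and push it through the vertex, each point splitting equally onto the two
other legs, so that it fills two segments of length `ε` there. Every particle travels the same
distance `D = 7 ε`, and at half time the whole mass is still on the first leg, in a segment of
length `ε`. Both inequalities at `t = 1/2` would require, up to the curvature term, log-volume `log
ε + (log 2) / 2` at the midpoint, but only `log ε` is available. The curvature term is at most `|K|
D² / 8` in absolute value, which is of order `ε²`, while the deficit `(log 2) / 2` does not depend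
on scale; a small `ε` therefore defeats any `K`.

Midpoints are located by duality, without describing geodesics or optimal plans. A bounded
1-Lipschitz function `f` (signed height above the vertex) drops along each transported pair by
exactly the length of the path. For sets, this forces the height of each intermediate point
(`intermediateSet_subset`). For measures, the difference of the means of `f` is `D`, which is also
an upper bound for the Wasserstein distance; the equality case of Cauchy–Schwarz then makes `f` drop
by `D / 2` almost surely under nearly optimal plans to a midpoint (`ae_mem_Icc_of_midpoint`).
Jensen's inequality (`neg_log_le_relEntropy`) turns the confinement into an entropy bound.

`BranchingConfig` isolates what this argument uses. On the graph, the height is built from tents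
vanishing at every vertex. A tent takes each value below its top twice, so two widths are used:
together they single out the part of the level set next to the vertex. -/

theorem IsCoupling.isProbabilityMeasure {ν₀ ν₁ : Measure X} {π : Measure (X × X)}
    (h : IsCoupling ν₀ ν₁ π) [IsProbabilityMeasure ν₀] : IsProbabilityMeasure π := by
  constructor
  have := measure_univ (μ := ν₀)
  rwa [← h.1, Measure.map_apply measurable_fst .univ, preimage_univ] at this

/-- The difference of the values of a function, integrated against a coupling. -/
theorem IsCoupling.integral_sub {ν₀ ν₁ : Measure X} {π : Measure (X × X)}
    (h : IsCoupling ν₀ ν₁ π) (hfm : Measurable f) (h₀ : Integrable f ν₀) (h₁ : Integrable f ν₁) :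
    ∫ p, (f p.1 - f p.2) ∂π = ∫ x, f x ∂ν₀ - ∫ x, f x ∂ν₁ := by
  have i₀ : Integrable (fun p : X × X => f p.1) π := by
    rw [← h.1] at h₀; exact h₀.comp_measurable measurable_fst
  have i₁ : Integrable (fun p : X × X => f p.2) π := by
    rw [← h.2] at h₁; exact h₁.comp_measurable measurable_snd
  rw [MeasureTheory.integral_sub i₀ i₁, ← h.1, ← h.2,
    integral_map measurable_fst.aemeasurable hfm.aestronglyMeasurable,
    integral_map measurable_snd.aemeasurable hfm.aestronglyMeasurable]

theorem integrable_of_abs_le {Y : Type*} [MeasurableSpace Y] {ν : Measure Y} [IsFiniteMeasure ν]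
    {g : Y → ℝ} (hg : Measurable g) {M : ℝ} (hM : ∀ y, |g y| ≤ M) : Integrable g ν :=
  Integrable.of_bound hg.aestronglyMeasurable M (.of_forall hM)

end Coupling

/-! ### Lipschitz functions and Wasserstein midpoints -/

section Transport

variable {X : Type*} [PseudoEMetricSpace X] [MeasurableSpace X]

theorem wasserstein_sq (ν₀ ν₁ : Measure X) :
    wasserstein ν₀ ν₁ ^ 2 =
      ⨅ (π : Measure (X × X)) (_ : IsCoupling ν₀ ν₁ π), ∫⁻ p, edist p.1 p.2 ^ 2 ∂π := by
  rw [wasserstein, ← ENNReal.rpow_natCast, ← ENNReal.rpow_mul]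
  norm_num

theorem IsCoupling.wasserstein_le {ν₀ ν₁ : Measure X} {π : Measure (X × X)}
    (h : IsCoupling ν₀ ν₁ π) {D : ℝ≥0∞} (hD : ∫⁻ p, edist p.1 p.2 ^ 2 ∂π ≤ D ^ 2) :
    wasserstein ν₀ ν₁ ≤ D := by
  rw [← ENNReal.pow_le_pow_left_iff (two_ne_zero), wasserstein_sq]
  exact (iInf₂_le π h).trans hD

/-- Strict slack replaces the existence of optimal couplings, which is never needed. -/
theorem exists_coupling_lt {ν₀ ν₁ : Measure X} {w c : ℝ≥0∞} (h : wasserstein ν₀ ν₁ ≤ w)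
    (hc : w ^ 2 < c) :
    ∃ π : Measure (X × X), IsCoupling ν₀ ν₁ π ∧ ∫⁻ p, edist p.1 p.2 ^ 2 ∂π < c := by
  have h2 : wasserstein ν₀ ν₁ ^ 2 < c := lt_of_le_of_lt (by gcongr) hc
  rw [wasserstein_sq] at h2
  simpa [iInf_lt_iff] using h2

variable {f : X → ℝ}

theorem integral_sq_sub_le {π : Measure (X × X)} (hfm : Measurable f)
    (hLip : ∀ x y, ENNReal.ofReal |f x - f y| ≤ edist x y) {c : ℝ} (hc : 0 ≤ c)
    (hcost : ∫⁻ p, edist p.1 p.2 ^ 2 ∂π ≤ ENNReal.ofReal c) :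
    ∫ p, (f p.1 - f p.2) ^ 2 ∂π ≤ c := by
  rw [integral_eq_lintegral_of_nonneg_ae (.of_forall fun p => sq_nonneg _)
    (Measurable.aestronglyMeasurable (by fun_prop))]
  refine ENNReal.toReal_le_of_le_ofReal hc (le_trans (lintegral_mono fun p => ?_) hcost)
  rw [← sq_abs, ENNReal.ofReal_pow (abs_nonneg _)]
  gcongr
  exact hLip _ _

/-- For couplings of cost at most `c`, the second moment of the deviation of `f x - f y`
from `a`. -/
theorem IsCoupling.integral_sq_dev_le {ν₀ ν₁ : Measure X} [IsProbabilityMeasure ν₀]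
    [IsProbabilityMeasure ν₁] {π : Measure (X × X)} (h : IsCoupling ν₀ ν₁ π) (hfm : Measurable f)
    (hLip : ∀ x y, ENNReal.ofReal |f x - f y| ≤ edist x y) {M : ℝ} (hM : ∀ x, |f x| ≤ M)
    {c : ℝ} (hc : 0 ≤ c) (hcost : ∫⁻ p, edist p.1 p.2 ^ 2 ∂π ≤ ENNReal.ofReal c) (a : ℝ) :
    ∫ p, (f p.1 - f p.2 - a) ^ 2 ∂π
      ≤ c - 2 * a * (∫ x, f x ∂ν₀ - ∫ x, f x ∂ν₁) + a ^ 2 := by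
  have := h.isProbabilityMeasure
  have hm : Measurable fun p : X × X => f p.1 - f p.2 :=
    (hfm.comp measurable_fst).sub (hfm.comp measurable_snd)
  have hb : ∀ p : X × X, |f p.1 - f p.2| ≤ 2 * M := fun p =>
    (abs_sub _ _).trans (by linarith [hM p.1, hM p.2])
  have i₁ : Integrable (fun p : X × X => f p.1 - f p.2) π := integrable_of_abs_le hm hb
  have i₂ : Integrable (fun p : X × X => (f p.1 - f p.2) ^ 2) π :=
    integrable_of_abs_le (hm.pow_const 2) (M := (2 * M) ^ 2) fun p => by
      rw [abs_pow]; exact pow_le_pow_left₀ (abs_nonneg _) (hb p) 2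
  have e : ∀ p : X × X, (f p.1 - f p.2 - a) ^ 2 =
      (f p.1 - f p.2) ^ 2 - 2 * a * (f p.1 - f p.2) + a ^ 2 := fun p => by ring
  simp_rw [e]
  have i₃ : Integrable (fun p : X × X => (f p.1 - f p.2) ^ 2 - 2 * a * (f p.1 - f p.2)) π :=
    i₂.sub (i₁.const_mul _)
  rw [integral_add i₃ (integrable_const _),
    MeasureTheory.integral_sub i₂ (i₁.const_mul _), integral_const_mul,
    h.integral_sub hfm (integrable_of_abs_le hfm hM) (integrable_of_abs_le hfm hM)]
  have := integral_sq_sub_le hfm hLip hc hcost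
  simp only [integral_const, probReal_univ, one_smul]
  linarith

/-- The easy half of Kantorovich duality: the deviation of `f x - f y` from its mean `m` has
nonnegative second moment, so `m²` is at most the transport cost. -/
theorem integral_sub_le_of_wasserstein_le {ν₀ ν₁ : Measure X} [IsProbabilityMeasure ν₀]
    [IsProbabilityMeasure ν₁] (hfm : Measurable f)
    (hLip : ∀ x y, ENNReal.ofReal |f x - f y| ≤ edist x y) {M : ℝ} (hM : ∀ x, |f x| ≤ M)
    {w : ℝ} (hw : 0 ≤ w) (h : wasserstein ν₀ ν₁ ≤ ENNReal.ofReal w) :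
    ∫ x, f x ∂ν₀ - ∫ x, f x ∂ν₁ ≤ w := by
  set m := ∫ x, f x ∂ν₀ - ∫ x, f x ∂ν₁ with hm
  refine abs_le_of_sq_le_sq' ?_ hw |>.2
  refine le_of_forall_pos_le_add fun δ hδ => ?_
  obtain ⟨π, hπ, hcost⟩ := exists_coupling_lt h (c := ENNReal.ofReal (w ^ 2 + δ)) (by
    rw [← ENNReal.ofReal_pow hw]; exact (ENNReal.ofReal_lt_ofReal_iff (by positivity)).2 (by linarith))
  have := hπ.integral_sq_dev_le hfm hLip hM (by positivity) hcost.le m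
  have h0 : 0 ≤ ∫ p, (f p.1 - f p.2 - m) ^ 2 ∂π := integral_nonneg fun p => sq_nonneg _
  rw [← hm] at this
  nlinarith

/-- A midpoint `ν` of `ν₀` and `ν₁` is concentrated where `f` is shifted by half the distance, if
the distance of `ν₀` and `ν₁` is the difference of the means of the Lipschitz function `f`. -/
theorem ae_mem_Icc_of_midpoint {ν₀ ν ν₁ : Measure X} [IsProbabilityMeasure ν₀]
    [IsProbabilityMeasure ν] [IsProbabilityMeasure ν₁] (hfm : Measurable f)
    (hLip : ∀ x y, ENNReal.ofReal |f x - f y| ≤ edist x y) {M : ℝ} (hM : ∀ x, |f x| ≤ M)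
    {w : ℝ} (hw : 0 ≤ w) (h₀ : wasserstein ν₀ ν ≤ ENNReal.ofReal w)
    (h₁ : wasserstein ν ν₁ ≤ ENNReal.ofReal w)
    (hmean : ∫ x, f x ∂ν₀ - ∫ x, f x ∂ν₁ = 2 * w) {p q : ℝ} (hpq : ∀ᵐ x ∂ν₀, f x ∈ Icc p q) :
    ∀ᵐ x ∂ν, f x ∈ Icc (p - w) (q - w) := by
  have hmid := integral_sub_le_of_wasserstein_le hfm hLip hM hw h₁
  -- `φ z` is the distance of `f z` from the target interval `[p - w, q - w]`.
  let φ : X → ℝ := fun z => max 0 (max (f z - (q - w)) (p - w - f z))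
  have hφm : Measurable φ := by fun_prop
  have hφ0 : ∀ z, 0 ≤ φ z := fun z => le_max_left _ _
  have hint : ∫⁻ z, ENNReal.ofReal (φ z ^ 2) ∂ν = 0 := by
    refine le_antisymm (ENNReal.le_of_forall_pos_le_add fun δ hδ _ => ?_) zero_le
    rw [zero_add]
    have hδ' : (0 : ℝ) < δ := hδ
    obtain ⟨π, hπ, hcost⟩ := exists_coupling_lt h₀ (c := ENNReal.ofReal (w ^ 2 + δ)) (by
      rw [← ENNReal.ofReal_pow hw]
      exact (ENNReal.ofReal_lt_ofReal_iff (by positivity)).2 (by linarith))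
    have := hπ.isProbabilityMeasure
    -- By `hmid` and `hmean` the means of `f` under `ν₀` and `ν` differ by at least `w`, so this
    -- bound is at most `w² + δ - 2 w² + w² = δ`.
    have hdev := hπ.integral_sq_dev_le hfm hLip hM (by positivity) hcost.le w
    have hae : ∀ᵐ r ∂π, f r.1 ∈ Icc p q :=
      ae_of_ae_map measurable_fst.aemeasurable (hπ.1.symm ▸ hpq)
    calc ∫⁻ z, ENNReal.ofReal (φ z ^ 2) ∂ν
        = ∫⁻ r, ENNReal.ofReal (φ r.2 ^ 2) ∂π := by
          rw [← hπ.2, lintegral_map (hφm.pow_const 2).ennreal_ofReal measurable_snd]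
      _ ≤ ∫⁻ r, ENNReal.ofReal ((f r.1 - f r.2 - w) ^ 2) ∂π := by
          refine lintegral_mono_ae (hae.mono fun r hr => ENNReal.ofReal_le_ofReal ?_)
          rw [← sq_abs (f r.1 - f r.2 - w)]
          refine pow_le_pow_left₀ (hφ0 _) (max_le (abs_nonneg _) (max_le ?_ ?_)) 2
          · linarith [neg_abs_le (f r.1 - f r.2 - w), hr.2]
          · linarith [le_abs_self (f r.1 - f r.2 - w), hr.1]
      _ = ENNReal.ofReal (∫ r, (f r.1 - f r.2 - w) ^ 2 ∂π) := by
          rw [ofReal_integral_eq_lintegral_ofReal _ (.of_forall fun r => sq_nonneg _)]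
          refine integrable_of_abs_le (M := (2 * M + w) ^ 2) (by fun_prop) fun r => ?_
          rw [abs_pow]
          refine pow_le_pow_left₀ (abs_nonneg _) ?_ 2
          refine (abs_sub _ _).trans (add_le_add ((abs_sub _ _).trans ?_) (abs_of_nonneg hw).le)
          linarith [hM r.1, hM r.2]
      _ ≤ δ := by
          rw [← ENNReal.ofReal_coe_nnreal]
          refine ENNReal.ofReal_le_ofReal (hdev.trans ?_)
          nlinarith
  rw [lintegral_eq_zero_iff (hφm.pow_const 2).ennreal_ofReal] at hint
  filter_upwards [hint] with z hz
  have h2 : φ z ^ 2 ≤ 0 := by simpa using hz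
  have h3 : φ z ≤ 0 := by nlinarith [hφ0 z]
  have h4 := (max_le_iff.1 h3).2
  rw [max_le_iff] at h4
  constructor <;> linarith [h4.1, h4.2]

end Transport

/-! ### Relative entropy: uniform measures and Jensen's inequality -/

section Entropy

variable {X : Type*} [MeasurableSpace X]

/-- The entropy of a normalized restriction. -/
theorem relEntropy_smul_restrict (μ : Measure X) [SigmaFinite μ] {A : Set X}
    (hA : MeasurableSet A) {m : ℝ} (hm : 0 < m) (hμ : μ A = ENNReal.ofReal m) :
    relEntropy ((μ A)⁻¹ • μ.restrict A) μ = ((-Real.log m : ℝ) : EReal) := by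
  set ν := (μ A)⁻¹ • μ.restrict A with hν
  have hdens : ν = μ.withDensity (A.indicator fun _ => (μ A)⁻¹) := by
    rw [withDensity_indicator hA, withDensity_const]
  have hac : ν ≪ μ := hdens ▸ withDensity_absolutelyContinuous _ _
  have hrn : ν.rnDeriv μ =ᵐ[μ] A.indicator fun _ => (μ A)⁻¹ := by
    rw [hdens]; exact Measure.rnDeriv_withDensity μ (measurable_const.indicator hA)
  -- The values `c = 1` and `c = -1` give the positive and the negative part of the entropy
  -- integral.
  have key : ∀ c : ℝ, ∫⁻ x, ENNReal.ofReal
      (c * ((ν.rnDeriv μ x).toReal * Real.log (ν.rnDeriv μ x).toReal)) ∂μ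
        = ENNReal.ofReal (c * -Real.log m) := by
    intro c
    calc _ = ∫⁻ x, A.indicator (fun _ => ENNReal.ofReal (c * (m⁻¹ * -Real.log m))) x ∂μ := by
          refine lintegral_congr_ae (hrn.mono fun x hx => ?_)
          simp only [hx]
          by_cases hxA : x ∈ A
          · simp [hxA, hμ, ENNReal.toReal_inv, hm.le]
          · simp [hxA]
      _ = ENNReal.ofReal (c * -Real.log m) := by
          rw [lintegral_indicator_const hA, hμ, ← ENNReal.ofReal_mul' hm.le]
          congr 1
          field_simp
  have k1 := key 1
  have k2 := key (-1)
  simp only [one_mul, neg_mul] at k1 k2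
  rw [relEntropy]
  simp only
  rw [if_pos ⟨hac, k1 ▸ ENNReal.ofReal_ne_top⟩, k1, k2]
  rcases le_total 0 (Real.log m) with h | h
  · simp [ENNReal.ofReal_of_nonpos, h, EReal.coe_ennreal_ofReal]
  · simp [ENNReal.ofReal_of_nonpos, h, EReal.coe_ennreal_ofReal]

/-- Convexity of `r log r`: the left side is its tangent line at `a`, with the value at `r = 0`
included. -/
theorem mul_log_tangent {a r : ℝ} (ha : 0 < a) (hr : 0 ≤ r) :
    r * Real.log a + r - a ≤ r * Real.log r := by
  rcases hr.eq_or_lt with rfl | hr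
  · simp [ha.le]
  · have h := Real.log_le_sub_one_of_pos (div_pos ha hr)
    rw [Real.log_div ha.ne' hr.ne'] at h
    have h2 := mul_le_mul_of_nonneg_left h hr.le
    have : r * (a / r - 1) = a - r := by field_simp
    linarith

/-- Jensen's inequality for the entropy of a measure that is concentrated on `S`. -/
theorem neg_log_le_relEntropy (μ ν : Measure X) [SigmaFinite μ] [IsProbabilityMeasure ν]
    {S : Set X} (hS : MeasurableSet S) (hνS : ∀ᵐ x ∂ν, x ∈ S) {m : ℝ} (hm : 0 < m)
    (hμ : μ S ≤ ENNReal.ofReal m) : ((-Real.log m : ℝ) : EReal) ≤ relEntropy ν μ := by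
  rw [relEntropy]
  set ρ : X → ℝ := fun x => (ν.rnDeriv μ x).toReal with hρ
  simp only
  split_ifs with hcond
  swap
  · exact le_top
  obtain ⟨hac, hfin⟩ := hcond
  have hρm : Measurable ρ := (Measure.measurable_rnDeriv ν μ).ennreal_toReal
  have hhm : Measurable fun x => ρ x * Real.log (ρ x) := by fun_prop
  have hρ0 : ∀ x, 0 ≤ ρ x := fun x => ENNReal.toReal_nonneg
  have hρi : Integrable ρ μ := Measure.integrable_toReal_rnDeriv
  have hρ1 : ∫ x, ρ x ∂μ = 1 := by
    rw [hρ, Measure.integral_toReal_rnDeriv hac]; simp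
  have hout : ∀ᵐ x ∂μ, x ∉ S → ρ x = 0 := by
    have h0 : ∫⁻ x in Sᶜ, ν.rnDeriv μ x ∂μ = 0 := by
      rw [Measure.setLIntegral_rnDeriv hac]; exact hνS
    rw [lintegral_eq_zero_iff (Measure.measurable_rnDeriv ν μ),
      Filter.EventuallyEq, ae_restrict_iff' hS.compl] at h0
    filter_upwards [h0] with x hx hxS
    simp [hρ, hx hxS]
  have hSfin : μ S ≠ ∞ := ne_top_of_le_ne_top ENNReal.ofReal_ne_top hμ
  -- The tangent at `1` gives `-r log r ≤ 1 - r ≤ 1`, and the integrand vanishes off `S`, which has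
  -- finite measure.
  have hneg : ∫⁻ x, ENNReal.ofReal (-(ρ x * Real.log (ρ x))) ∂μ ≠ ∞ := by
    refine ne_top_of_le_ne_top hSfin ?_
    rw [← lintegral_indicator_one hS]
    refine lintegral_mono_ae (hout.mono fun x hx => ?_)
    by_cases hxS : x ∈ S
    · have := mul_log_tangent one_pos (hρ0 x)
      simp only [Real.log_one, mul_zero] at this
      simp only [hxS, indicator_of_mem, Pi.one_apply]
      exact ENNReal.ofReal_le_one.2 (by linarith [hρ0 x])
    · simp [hxS, hx hxS]
  have hint : Integrable (fun x => ρ x * Real.log (ρ x)) μ := by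
    refine ⟨hhm.aestronglyMeasurable, ?_⟩
    rw [hasFiniteIntegral_iff_norm]
    calc _ = ∫⁻ x, (ENNReal.ofReal (ρ x * Real.log (ρ x))
          + ENNReal.ofReal (-(ρ x * Real.log (ρ x)))) ∂μ := by
          refine lintegral_congr fun x => ?_
          rw [Real.norm_eq_abs]
          rcases le_total 0 (ρ x * Real.log (ρ x)) with h | h
          · rw [abs_of_nonneg h, ENNReal.ofReal_of_nonpos (neg_nonpos.2 h), add_zero]
          · rw [abs_of_nonpos h, ENNReal.ofReal_of_nonpos h, zero_add]
      _ < ∞ := by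
          rw [lintegral_add_left hhm.ennreal_ofReal]
          exact ENNReal.add_lt_top.2 ⟨hfin.lt_top, hneg.lt_top⟩
  have heq := integral_eq_lintegral_pos_part_sub_lintegral_neg_part hint
  have hlow : -Real.log m ≤ ∫ x, ρ x * Real.log (ρ x) ∂μ := by
    have hind : Integrable (S.indicator fun _ => m⁻¹) μ :=
      (integrable_indicator_iff hS).2 (integrableOn_const hSfin)
    -- Tangent at `m⁻¹`, the density of a uniform measure of support mass `m`. Its constant term is
    -- kept only on `S`, since the total mass of `μ` may be infinite.
    have hmono : ∫ x, ((ρ x * Real.log m⁻¹ + ρ x) - S.indicator (fun _ => m⁻¹) x) ∂μ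
        ≤ ∫ x, ρ x * Real.log (ρ x) ∂μ := by
      refine integral_mono_ae (((hρi.mul_const _).add hρi).sub hind) hint
        (hout.mono fun x hx => ?_)
      by_cases hxS : x ∈ S
      · simpa [hxS] using mul_log_tangent (inv_pos.2 hm) (hρ0 x)
      · simp [hxS, hx hxS]
    have hadd : Integrable (fun x => ρ x * Real.log m⁻¹ + ρ x) μ := (hρi.mul_const _).add hρi
    rw [MeasureTheory.integral_sub hadd hind,
      integral_add (hρi.mul_const _) hρi, integral_mul_const, hρ1,
      integral_indicator_const _ hS, Real.log_inv] at hmono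
    have hSm : μ.real S * m⁻¹ ≤ 1 := by
      rw [← div_eq_mul_inv, div_le_one hm]
      exact ENNReal.toReal_le_of_le_ofReal hm.le hμ
    simp only [smul_eq_mul] at hmono
    linarith
  rw [heq] at hlow
  rw [← EReal.coe_ennreal_toReal hfin, ← EReal.coe_ennreal_toReal hneg]
  exact_mod_cast hlow

end Entropy


/-! ### Abstract branching and the failure of both inequalities -/

/-- A configuration in which mass `ε` on `A`, parametrized by `α`, is transported over the constant
distance `D` onto two branches, parametrized by `β` and `γ`, of total mass `2 ε`, while the
midpoints are confined, by means of the Lipschitz functions `f i`, to a set of mass at most `ε`. -/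
structure BranchingConfig {X : Type*} [PseudoEMetricSpace X] [MeasurableSpace X]
    (μ : Measure X) (ι : Type*) (ε D p : ℝ) where
  A : Set X
  B : Set X
  α : ℝ → X
  β : ℝ → X
  γ : ℝ → X
  f : ι → X → ℝ
  pos : 0 < ε
  le : ε ≤ D
  measurable_A : MeasurableSet A
  measurable_B : MeasurableSet B
  measurable_α : Measurable α
  measurable_β : Measurable β
  measurable_γ : Measurable γ
  restrict_A : μ.restrict A = (volume.restrict (Icc 0 ε)).map α
  restrict_B : μ.restrict B = (volume.restrict (Icc 0 ε)).map β
    + (volume.restrict (Icc 0 ε)).map γ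
  exists_A : ∀ x ∈ A, ∃ t ∈ Icc 0 ε, x = α t
  exists_B : ∀ x ∈ B, ∃ t ∈ Icc 0 ε, x = β t ∨ x = γ t
  edist_β : ∀ s ∈ Icc 0 ε, ∀ t ∈ Icc 0 ε, edist (α s) (β t) ≤ ENNReal.ofReal (D + s - t)
  edist_γ : ∀ s ∈ Icc 0 ε, ∀ t ∈ Icc 0 ε, edist (α s) (γ t) ≤ ENNReal.ofReal (D + s - t)
  lipschitz : ∀ i x y, ENNReal.ofReal |f i x - f i y| ≤ edist x y
  bounded : ∀ i, ∃ M, ∀ x, |f i x| ≤ M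
  f_α : ∀ i, ∀ t ∈ Icc 0 ε, f i (α t) = p + t
  f_β : ∀ i, ∀ t ∈ Icc 0 ε, f i (β t) = p - D + t
  f_γ : ∀ i, ∀ t ∈ Icc 0 ε, f i (γ t) = p - D + t
  measure_le : μ {x | ∀ i, f i x ∈ Icc (p - D / 2) (p + ε - D / 2)} ≤ ENNReal.ofReal ε

namespace BranchingConfig

variable {X : Type*} [PseudoEMetricSpace X] [MeasurableSpace X] {μ : Measure X} {ι : Type*}
  {ε D p : ℝ} (c : BranchingConfig μ ι ε D p)

/-- The normalized restriction of the reference measure to `A`. -/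
noncomputable def ν₀ : Measure X := (μ c.A)⁻¹ • μ.restrict c.A

/-- The normalized restriction of the reference measure to `B`. -/
noncomputable def ν₁ : Measure X := (μ c.B)⁻¹ • μ.restrict c.B

/-- The set that carries the midpoints. -/
noncomputable def S : Set X := {x | ∀ i, c.f i x ∈ Icc (p - D / 2) (p + ε - D / 2)}

theorem nonneg (c : BranchingConfig μ ι ε D p) : 0 ≤ D := c.pos.le.trans c.le

theorem measure_A : μ c.A = ENNReal.ofReal ε := by
  rw [← Measure.restrict_apply_univ, c.restrict_A, Measure.map_apply c.measurable_α .univ]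
  simp

theorem measure_B : μ c.B = ENNReal.ofReal (2 * ε) := by
  rw [← Measure.restrict_apply_univ, c.restrict_B, Measure.add_apply,
    Measure.map_apply c.measurable_β .univ, Measure.map_apply c.measurable_γ .univ, two_mul,
    ENNReal.ofReal_add c.pos.le c.pos.le]
  simp

theorem measure_A_ne_zero : μ c.A ≠ 0 := by simp [c.measure_A, c.pos]

theorem measure_A_ne_top : μ c.A ≠ ∞ := by simp [c.measure_A]

theorem measure_B_ne_zero : μ c.B ≠ 0 := by simp [c.measure_B, c.pos]

theorem measure_B_ne_top : μ c.B ≠ ∞ := c.measure_B ▸ ENNReal.ofReal_ne_top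

instance : IsProbabilityMeasure c.ν₀ :=
  ⟨by simp [ν₀, ENNReal.inv_mul_cancel c.measure_A_ne_zero c.measure_A_ne_top]⟩

instance : IsProbabilityMeasure c.ν₁ :=
  ⟨by simp [ν₁, ENNReal.inv_mul_cancel c.measure_B_ne_zero c.measure_B_ne_top]⟩

theorem ae_mem_A : ∀ᵐ x ∂c.ν₀, x ∈ c.A :=
  Measure.ae_smul_measure (ae_restrict_mem c.measurable_A) _

theorem ae_mem_B : ∀ᵐ x ∂c.ν₁, x ∈ c.B :=
  Measure.ae_smul_measure (ae_restrict_mem c.measurable_B) _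

/-- The transport plan along the two branches. -/
noncomputable def plan : Measure (X × X) :=
  (μ c.B)⁻¹ • ((volume.restrict (Icc 0 ε)).map (fun t => (c.α t, c.β t))
    + (volume.restrict (Icc 0 ε)).map (fun t => (c.α t, c.γ t)))

theorem isCoupling_plan : IsCoupling c.ν₀ c.ν₁ c.plan := by
  have hβ : Measurable fun t => (c.α t, c.β t) := c.measurable_α.prodMk c.measurable_β
  have hγ : Measurable fun t => (c.α t, c.γ t) := c.measurable_α.prodMk c.measurable_γ
  constructor
  · rw [plan, Measure.map_smul, Measure.map_add _ _ measurable_fst,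
      Measure.map_map measurable_fst hβ, Measure.map_map measurable_fst hγ]
    have e : ∀ g : ℝ → X, (Prod.fst ∘ fun t => (c.α t, g t)) = c.α := fun g => rfl
    rw [e, e, ← c.restrict_A, ν₀, ← two_smul ℝ≥0∞, smul_smul]
    congr 1
    rw [c.measure_A, c.measure_B, ENNReal.ofReal_mul two_pos.le,
      ENNReal.mul_inv (by simp) (by simp), ENNReal.ofReal_ofNat, mul_right_comm,
      ENNReal.inv_mul_cancel two_ne_zero ENNReal.ofNat_ne_top, one_mul]
  · rw [plan, Measure.map_smul, Measure.map_add _ _ measurable_snd,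
      Measure.map_map measurable_snd hβ, Measure.map_map measurable_snd hγ]
    have e : ∀ g : ℝ → X, (Prod.snd ∘ fun t => (c.α t, g t)) = g := fun g => rfl
    rw [e, e, ← c.restrict_B, ν₁]

/-- The plan pairs equal parameters, for which the distance bound `D + s - t` reduces to `D`. -/
theorem wasserstein_le : wasserstein c.ν₀ c.ν₁ ≤ ENNReal.ofReal D := by
  refine c.isCoupling_plan.wasserstein_le ?_
  have key : ∀ g : ℝ → X, (∀ s ∈ Icc 0 ε, ∀ t ∈ Icc 0 ε,
      edist (c.α s) (g t) ≤ ENNReal.ofReal (D + s - t)) →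
      ∫⁻ q, edist q.1 q.2 ^ 2 ∂(volume.restrict (Icc 0 ε)).map (fun t => (c.α t, g t))
        ≤ ENNReal.ofReal D ^ 2 * ENNReal.ofReal ε := by
    intro g hg
    refine (lintegral_map_le _ _).trans ?_
    calc ∫⁻ t in Icc 0 ε, edist (c.α t) (g t) ^ 2 ≤ ∫⁻ t in Icc 0 ε, ENNReal.ofReal D ^ 2 :=
          setLIntegral_mono measurable_const fun t ht => by
            have := hg t ht t ht
            rw [add_sub_cancel_right] at this
            gcongr
      _ = _ := by simp
  rw [plan, lintegral_smul_measure, lintegral_add_measure]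
  refine (mul_le_mul_right (add_le_add (key _ c.edist_β) (key _ c.edist_γ)) _).trans_eq ?_
  rw [← mul_add, ← ENNReal.ofReal_add c.pos.le c.pos.le, ← two_mul, ← c.measure_B,
    mul_left_comm, ENNReal.inv_mul_cancel c.measure_B_ne_zero c.measure_B_ne_top, mul_one]

theorem nonneg_add (c : BranchingConfig μ ι ε D p) {s t : ℝ} (hs : s ∈ Icc 0 ε) (ht : t ∈ Icc 0 ε) : 0 ≤ D + s - t := by
  linarith [hs.1, ht.2, c.le]

theorem edist_le {x y : X} (hx : x ∈ c.A) (hy : y ∈ c.B) :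
    ∃ s ∈ Icc 0 ε, ∃ t ∈ Icc 0 ε, edist x y ≤ ENNReal.ofReal (D + s - t) ∧
      ∀ i, c.f i x = p + s ∧ c.f i y = p - D + t := by
  obtain ⟨s, hs, rfl⟩ := c.exists_A x hx
  obtain ⟨t, ht, rfl | rfl⟩ := c.exists_B y hy
  · exact ⟨s, hs, t, ht, c.edist_β s hs t ht, fun i => ⟨c.f_α i s hs, c.f_β i t ht⟩⟩
  · exact ⟨s, hs, t, ht, c.edist_γ s hs t ht, fun i => ⟨c.f_α i s hs, c.f_γ i t ht⟩⟩

theorem edist_le_const {x y : X} (hx : x ∈ c.A) (hy : y ∈ c.B) :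
    edist x y ≤ ENNReal.ofReal (D + ε) := by
  obtain ⟨s, hs, t, ht, h, -⟩ := c.edist_le hx hy
  exact h.trans (ENNReal.ofReal_le_ofReal (by linarith [hs.2, ht.1]))

theorem nonempty_A : c.A.Nonempty := nonempty_of_measure_ne_zero c.measure_A_ne_zero

theorem nonempty_B : c.B.Nonempty := nonempty_of_measure_ne_zero c.measure_B_ne_zero

theorem ediam_lt_top : Metric.ediam (c.A ∪ c.B) < ∞ := by
  obtain ⟨a, ha⟩ := c.nonempty_A
  obtain ⟨b, hb⟩ := c.nonempty_B
  set C := ENNReal.ofReal (D + ε)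
  have h : ∀ x ∈ c.A ∪ c.B, edist x a ≤ C + C := by
    rintro x (hx | hx)
    · exact (edist_triangle x b a).trans
        (add_le_add (c.edist_le_const hx hb) (edist_comm b a ▸ c.edist_le_const ha hb))
    · exact (edist_comm x a ▸ c.edist_le_const ha hx).trans le_self_add
  refine lt_of_le_of_lt (Metric.ediam_le (d := (C + C) + (C + C)) fun x hx y hy => ?_) (by simp [C])
  exact (edist_triangle x a y).trans (add_le_add (h x hx) (edist_comm a y ▸ h y hy))

theorem memP2_of_ae {ν : Measure X} [IsProbabilityMeasure ν] {x₀ : X} {C : ℝ}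
    (h : ∀ᵐ x ∂ν, edist x x₀ ≤ ENNReal.ofReal C) : MemP2 ν := by
  refine ⟨inferInstance, x₀, lt_of_le_of_lt (b := ENNReal.ofReal C ^ 2) ?_ (by simp)⟩
  calc ∫⁻ x, edist x x₀ ^ 2 ∂ν ≤ ∫⁻ _, ENNReal.ofReal C ^ 2 ∂ν :=
        lintegral_mono_ae (h.mono fun x hx => by gcongr)
    _ = _ := by simp

theorem memP2_ν₀ : MemP2 c.ν₀ := by
  obtain ⟨b, hb⟩ := c.nonempty_B
  exact memP2_of_ae (c.ae_mem_A.mono fun x hx => c.edist_le_const hx hb)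

theorem memP2_ν₁ : MemP2 c.ν₁ := by
  obtain ⟨a, ha⟩ := c.nonempty_A
  exact memP2_of_ae (c.ae_mem_B.mono fun x hx => edist_comm x a ▸ c.edist_le_const ha hx)

/-- The drop of each `f i` from `x` to `y` is `D + s - t`, an upper bound for their distance. The
Lipschitz bounds from both ends therefore pin the height of `z` to `p - D / 2 + (s + t) / 2`. -/
theorem intermediateSet_subset : intermediateSet c.A c.B (1 / 2) ⊆ c.S := by
  rintro z ⟨x, hx, y, hy, hxz, hzy⟩ i
  obtain ⟨s, hs, t, ht, hxy, hf⟩ := c.edist_le hx hy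
  have h1 := c.lipschitz i x z
  have h2 := c.lipschitz i z y
  have hn := c.nonneg_add hs ht
  have half : ENNReal.ofReal (1 / 2) * edist x y ≤ ENNReal.ofReal (1 / 2 * (D + s - t)) := by
    rw [ENNReal.ofReal_mul (by norm_num)]
    gcongr
  rw [hxz, show (1 : ℝ) - 1 / 2 = 1 / 2 by norm_num] at h1
  rw [hzy] at h2
  replace h1 := (ENNReal.ofReal_le_ofReal_iff (by positivity)).1 (h1.trans half)
  replace h2 := (ENNReal.ofReal_le_ofReal_iff (by positivity)).1 (h2.trans half)
  rw [(hf i).1, abs_le] at h1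
  rw [(hf i).2, abs_le] at h2
  constructor <;> linarith [hs.1, hs.2, ht.1, ht.2, h1.1, h1.2, h2.1, h2.2]

/-- The curvature term, with `K / 8 = (K / 2) (1 / 2) (1 / 2)`, cannot compensate the deficit `log 2
/ 2`, whatever the sign of `K`. -/
theorem mul_wasserstein_sq {K : ℝ} (hK : |K| * D ^ 2 / 8 < Real.log 2 / 2) :
    ∃ w : ℝ, ((wasserstein c.ν₀ c.ν₁ ^ 2 : ℝ≥0∞) : EReal) = (w : EReal) ∧
      -(Real.log 2 / 2) < K / 8 * w := by
  have hW := c.wasserstein_le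
  have hfin : wasserstein c.ν₀ c.ν₁ ^ 2 ≠ ∞ :=
    ENNReal.pow_ne_top (ne_top_of_le_ne_top ENNReal.ofReal_ne_top hW)
  refine ⟨(wasserstein c.ν₀ c.ν₁ ^ 2).toReal, (EReal.coe_ennreal_toReal hfin).symm, ?_⟩
  have hle : (wasserstein c.ν₀ c.ν₁ ^ 2).toReal ≤ D ^ 2 := by
    refine ENNReal.toReal_le_of_le_ofReal (sq_nonneg D) ?_
    rw [ENNReal.ofReal_pow c.nonneg]
    gcongr
  have h0 : 0 ≤ (wasserstein c.ν₀ c.ν₁ ^ 2).toReal := ENNReal.toReal_nonneg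
  have h1 : |K| * (wasserstein c.ν₀ c.ν₁ ^ 2).toReal ≤ |K| * D ^ 2 := by gcongr
  have h2 := mul_le_mul_of_nonneg_right (neg_abs_le K) h0
  linarith

theorem not_brunnMinkowski {K : ℝ} (hK : |K| * D ^ 2 / 8 < Real.log 2 / 2) :
    ¬ BrunnMinkowski μ K c.A c.B (1 / 2) := by
  intro h
  rw [BrunnMinkowski] at h
  have h2 := h.trans (ENNReal.log_monotone ((measure_mono c.intermediateSet_subset).trans
    c.measure_le))
  obtain ⟨w, hw, hKw⟩ := c.mul_wasserstein_sq hK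
  rw [ν₀, ν₁] at hw
  have hε := c.pos
  rw [hw, c.measure_A, c.measure_B, ENNReal.log_ofReal_of_pos hε,
    ENNReal.log_ofReal_of_pos (by positivity)] at h2
  norm_cast at h2
  rw [Real.log_mul two_ne_zero hε.ne'] at h2
  -- After cancelling `log ε`, `h2` says `log 2 / 2 + K / 8 * w ≤ 0`.
  linarith

variable [BorelSpace X]

theorem measurable_f (i : ι) : Measurable (c.f i) := by
  have : LipschitzWith 1 (c.f i) := fun x y => by
    rw [edist_dist, Real.dist_eq, ENNReal.coe_one, one_mul]
    exact c.lipschitz i x y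
  exact this.continuous.measurable

/-- The difference of means is the same for all couplings, so it may be computed with the explicit
plan, along which `f i` drops by exactly `D`. -/
theorem mean_sub (i : ι) : ∫ x, c.f i x ∂c.ν₀ - ∫ x, c.f i x ∂c.ν₁ = D := by
  obtain ⟨M, hM⟩ := c.bounded i
  have hm := c.measurable_f i
  have hp := c.isCoupling_plan
  have := hp.isProbabilityMeasure
  rw [← hp.integral_sub hm (integrable_of_abs_le hm hM) (integrable_of_abs_le hm hM)]
  have key : ∀ g : ℝ → X, Measurable g → (∀ t ∈ Icc 0 ε, c.f i (g t) = p - D + t) →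
      ∀ᵐ q ∂(volume.restrict (Icc 0 ε)).map (fun t => (c.α t, g t)),
        c.f i q.1 - c.f i q.2 = D := by
    intro g hg hfg
    rw [ae_map_iff (c.measurable_α.prodMk hg).aemeasurable
      (measurableSet_eq_fun (by fun_prop) measurable_const)]
    filter_upwards [ae_restrict_mem measurableSet_Icc] with t ht
    rw [hfg t ht, c.f_α i t ht]
    ring
  have hae : ∀ᵐ q ∂c.plan, c.f i q.1 - c.f i q.2 = D :=
    Measure.ae_smul_measure (ae_add_measure_iff.2
      ⟨key _ c.measurable_β (c.f_β i), key _ c.measurable_γ (c.f_γ i)⟩) _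
  rw [integral_congr_ae hae]
  simp

theorem measurableSet_S [Countable ι] : MeasurableSet c.S := by
  rw [S, ofPred_forall]
  exact MeasurableSet.iInter fun i => c.measurable_f i measurableSet_Icc

theorem not_cdInfty (c : BranchingConfig μ ι ε D p) [SigmaFinite μ] [Countable ι] {K : ℝ}
    (hK : |K| * D ^ 2 / 8 < Real.log 2 / 2) : ¬ CDInfty μ K := by
  intro h
  have hε := c.pos
  have hD := c.nonneg
  have e₀ : relEntropy c.ν₀ μ = ((-Real.log ε : ℝ) : EReal) :=
    relEntropy_smul_restrict μ c.measurable_A hε c.measure_A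
  have e₁ : relEntropy c.ν₁ μ = ((-Real.log (2 * ε) : ℝ) : EReal) :=
    relEntropy_smul_restrict μ c.measurable_B (by positivity) c.measure_B
  obtain ⟨Γ, ⟨hΓ0, hΓ1, hΓ⟩, hent⟩ := h c.ν₀ c.ν₁ c.memP2_ν₀ c.memP2_ν₁
    (e₀ ▸ EReal.coe_lt_top _) (e₁ ▸ EReal.coe_lt_top _)
    (c.wasserstein_le.trans_lt ENNReal.ofReal_lt_top)
  have hhalf : (1 / 2 : ℝ) ∈ Icc (0 : ℝ) 1 := by constructor <;> norm_num
  obtain ⟨⟨hprob, -⟩, -, hconv⟩ := hent (1 / 2) hhalf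
  have bound : ENNReal.ofReal (1 / 2) * wasserstein c.ν₀ c.ν₁ ≤ ENNReal.ofReal (D / 2) := by
    rw [show D / 2 = 1 / 2 * D by ring, ENNReal.ofReal_mul (by norm_num)]
    gcongr
    exact c.wasserstein_le
  have w₀ : wasserstein c.ν₀ (Γ (1 / 2)) ≤ ENNReal.ofReal (D / 2) := by
    have := hΓ 0 (by simp) (1 / 2) hhalf
    rw [hΓ0, show |(0 : ℝ) - 1 / 2| = 1 / 2 by norm_num [abs_of_neg]] at this
    exact this.trans_le bound
  have w₁ : wasserstein (Γ (1 / 2)) c.ν₁ ≤ ENNReal.ofReal (D / 2) := by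
    have := hΓ (1 / 2) hhalf 1 (by simp)
    rw [hΓ1, show |(1 / 2 : ℝ) - 1| = 1 / 2 by norm_num [abs_of_neg]] at this
    exact this.trans_le bound
  -- Nothing is known about the geodesic except its two half distances; these and `mean_sub` already
  -- confine its midpoint.
  have hS : ∀ᵐ z ∂Γ (1 / 2), z ∈ c.S := by
    refine ae_all_iff.2 fun i => ?_
    obtain ⟨M, hM⟩ := c.bounded i
    refine ae_mem_Icc_of_midpoint (c.measurable_f i) (c.lipschitz i) hM (by positivity) w₀ w₁
      ((c.mean_sub i).trans (by ring)) (c.ae_mem_A.mono fun x hx => ?_)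
    obtain ⟨t, ht, rfl⟩ := c.exists_A x hx
    rw [c.f_α i t ht]
    exact ⟨by linarith [ht.1], by linarith [ht.2]⟩
  have hlow := (neg_log_le_relEntropy μ (Γ (1 / 2)) c.measurableSet_S hS hε c.measure_le).trans
    hconv
  obtain ⟨w, hw, hKw⟩ := c.mul_wasserstein_sq hK
  rw [hw, e₀, e₁] at hlow
  norm_cast at hlow
  rw [Real.log_mul two_ne_zero hε.ne'] at hlow
  linarith

end BranchingConfig


/-! ### Coordinates, Lipschitz functions and the measure of a metric graph -/

namespace MetricGraph

variable {V E R : Type*} (G : MetricGraph V E R)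

theorem measurableSet_interval (a : E ⊕ R) : MeasurableSet (G.interval a) := by
  rcases a with e | r
  · exact measurableSet_Icc
  · exact measurableSet_Ici

/-- The nearest point projection of the real line onto the interval of an edge or ray. -/
noncomputable def toInterval : (a : E ⊕ R) → ℝ → G.interval a
  | .inl e => projIcc 0 (G.length e) (G.length_pos e).le
  | .inr _ => projIci 0

theorem continuous_toInterval (a : E ⊕ R) : Continuous (G.toInterval a) := by
  rcases a with e | r
  · exact continuous_projIcc (h := (G.length_pos e).le)
  · exact Continuous.subtype_mk (continuous_const.max continuous_id) _

theorem toInterval_of_mem {a : E ⊕ R} {s : ℝ} (hs : s ∈ G.interval a) :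
    G.toInterval a s = ⟨s, hs⟩ := by
  rcases a with e | r
  · exact projIcc_of_mem (G.length_pos e).le hs
  · exact projIci_of_mem hs

/-- A function that is `1`-Lipschitz on each edge and ray is `1`-Lipschitz. -/
theorem ofReal_abs_sub_le_edist {f : G.Point → ℝ}
    (hf : ∀ (a : E ⊕ R) (s s' : G.interval a),
      |f (G.proj a s) - f (G.proj a s')| ≤ |(s : ℝ) - s'|) (x y : G.Point) :
    ENNReal.ofReal |f x - f y| ≤ edist x y := by
  rw [G.edist_eq_iSup]
  exact le_iSup₂_of_le f hf le_rfl

theorem measurable_of_lipschitz {f : G.Point → ℝ}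
    (hf : ∀ (a : E ⊕ R) (s s' : G.interval a),
      |f (G.proj a s) - f (G.proj a s')| ≤ |(s : ℝ) - s'|) : Measurable f := by
  have : LipschitzWith 1 f := fun x y => by
    rw [edist_dist, Real.dist_eq, ENNReal.coe_one, one_mul]
    exact G.ofReal_abs_sub_le_edist hf x y
  exact this.continuous.measurable

theorem forall_point {P : G.Point → Prop} (h : ∀ a s, P (G.proj a s)) (x : G.Point) : P x :=
  Quotient.inductionOn x fun p => h p.1 p.2

theorem measure_apply {M : Set G.Point} (hM : MeasurableSet M) :
    G.measure M = ∑' a : E ⊕ R, volume (Subtype.val '' (G.proj a ⁻¹' M)) := by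
  rw [measure, Measure.sum_apply _ hM]
  refine tsum_congr fun a => ?_
  rw [Measure.map_apply (G.measurable_proj a) hM,
    comap_subtype_coe_apply (G.measurableSet_interval a)]

/-- The distance of a point of a ray from its root, extended by zero. -/
noncomputable def rayCoord : G.Point → ℝ :=
  Quotient.lift (fun p => Sum.elim (fun _ => 0) (fun _ => (p.2 : ℝ)) p.1) (by
    have key : ∀ (p : Σ a : E ⊕ R, G.interval a) (v : V), G.IsEnd p.1 p.2 v →
        Sum.elim (fun _ => (0 : ℝ)) (fun _ => (p.2 : ℝ)) p.1 = 0 := by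
      rintro ⟨e | r, s⟩ v h
      · rfl
      · exact h.1
    rintro p q (rfl | ⟨v, hp, hq⟩)
    · rfl
    · exact (key p v hp).trans (key q v hq).symm)

theorem measurable_rayCoord : Measurable G.rayCoord := by
  refine G.measurable_of_lipschitz fun a s s' => ?_
  rcases a with e | r
  · change |(0 : ℝ) - 0| ≤ _
    simp
  · exact le_rfl

/-- The sublevel sets of `rayCoord` contain all internal edges and an initial piece of each ray,
finitely many pieces of finite length. -/
instance sigmaFinite_measure [Finite E] [Finite R] : SigmaFinite G.measure := by
  have := Fintype.ofFinite E
  have := Fintype.ofFinite R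
  refine ⟨⟨⟨fun n : ℕ => G.rayCoord ⁻¹' Iic (n : ℝ), fun _ => trivial, fun n => ?_, ?_⟩⟩⟩
  · rw [G.measure_apply (G.measurable_rayCoord measurableSet_Iic), tsum_fintype]
    refine ENNReal.sum_lt_top.2 fun a _ => ?_
    rcases a with e | r
    · refine lt_of_le_of_lt (measure_mono (t := Icc 0 (G.length e)) ?_) (by simp)
      rintro _ ⟨s, -, rfl⟩
      exact s.2
    · refine lt_of_le_of_lt (measure_mono (t := Icc 0 (n : ℝ)) ?_) (by simp)
      rintro _ ⟨s, hs, rfl⟩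
      exact ⟨s.2, hs⟩
  · refine eq_univ_of_forall fun x => mem_iUnion.2 ?_
    exact exists_nat_ge (G.rayCoord x)

/-! ### Ends of edges and rays at a vertex -/

/-- An end of an edge or ray at the vertex `v`, with an orientation `σ` that points into the edge
and a lower bound `ℓ` of its length. -/
structure Leg (v : V) where
  a : E ⊕ R
  s₀ : ℝ
  σ : ℝ
  ℓ : ℝ
  isEnd : G.IsEnd a s₀ v
  sign : σ = 1 ∨ σ = -1
  pos : 0 < ℓ
  mem : ∀ u ∈ Icc 0 ℓ, s₀ + σ * u ∈ G.interval a
  eq : ∀ s ∈ G.interval a, s = s₀ + σ * |s - s₀|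
  far : ∀ s w, G.IsEnd a s w → s = s₀ ∨ ℓ ≤ |s - s₀|

theorem exists_leg {v : V} {a : E ⊕ R} {s₀ : ℝ} (h : G.IsEnd a s₀ v) :
    ∃ L : G.Leg v, L.a = a ∧ L.s₀ = s₀ := by
  rcases a with e | r
  · have hl := G.length_pos e
    have hfar : ∀ s w, G.IsEnd (.inl e : E ⊕ R) s w → s = 0 ∨ s = G.length e := by
      rintro s w (⟨h, -⟩ | ⟨h, -⟩)
      exacts [.inl h, .inr h]
    rcases id h with ⟨rfl, hv⟩ | ⟨rfl, hv⟩
    · refine ⟨⟨_, _, 1, G.length e, h, .inl rfl, hl, fun u hu => ?_, fun s hs => ?_,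
        fun s w hs => ?_⟩, rfl, rfl⟩
      · simpa [interval] using hu
      · simp [abs_of_nonneg hs.1]
      · rcases hfar s w hs with rfl | rfl
        · exact .inl rfl
        · exact .inr (by simp [abs_of_pos hl])
    · refine ⟨⟨_, _, -1, G.length e, h, .inr rfl, hl, fun u hu => ?_, fun s hs => ?_,
        fun s w hs => ?_⟩, rfl, rfl⟩
      · exact ⟨by linarith [hu.2], by linarith [hu.1]⟩
      · rw [abs_of_nonpos (sub_nonpos.2 hs.2)]
        ring
      · rcases hfar s w hs with rfl | rfl
        · exact .inr (by simp [abs_of_pos hl])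
        · exact .inl rfl
  · obtain ⟨rfl, hv⟩ := id h
    -- A ray has no second end, so any positive number serves as its length bound; `1` is an
    -- arbitrary choice.
    refine ⟨⟨_, _, 1, 1, h, .inl rfl, one_pos, fun u hu => ?_, fun s hs => ?_,
        fun s w hs => .inl hs.1⟩, rfl, rfl⟩
    · simpa [interval] using hu.1
    · simp [abs_of_nonneg (show 0 ≤ s from hs)]

namespace Leg

variable {G} {v : V} (L L' : G.Leg v)

theorem abs_σ : |L.σ| = 1 := by rcases L.sign with h | h <;> simp [h]

theorem σ_mul_σ : L.σ * L.σ = 1 := by rcases L.sign with h | h <;> simp [h]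

/-- The tent function of width `c` on the interval of `b`, based at the leg. -/
noncomputable def tentOn (c : ℝ) (b : E ⊕ R) (s : ℝ) : ℝ :=
  open Classical in if b = L.a then max 0 (min |s - L.s₀| (c - |s - L.s₀|)) else 0

/-- This lets the tent descend to the quotient: at its base the height is zero, and any other end
lies beyond the width `c`. -/
theorem tentOn_of_isEnd {c : ℝ} (hc : c ≤ L.ℓ) {b : E ⊕ R} {s : ℝ} {w : V}
    (h : G.IsEnd b s w) : L.tentOn c b s = 0 := by
  rw [tentOn]
  split_ifs with hb
  · subst hb
    apply max_eq_left
    rcases L.far s w h with rfl | h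
    · exact (min_le_left _ _).trans (by simp)
    · exact (min_le_right _ _).trans (by linarith)
  · rfl

theorem tentOn_nonneg (c : ℝ) (b : E ⊕ R) (s : ℝ) : 0 ≤ L.tentOn c b s := by
  rw [tentOn]
  split_ifs
  exacts [le_max_left _ _, le_rfl]

theorem tentOn_le {c : ℝ} (hc : 0 ≤ c) (b : E ⊕ R) (s : ℝ) : L.tentOn c b s ≤ c := by
  rw [tentOn]
  split_ifs
  · exact max_le hc ((min_le_right _ _).trans (by linarith [abs_nonneg (s - L.s₀)]))
  · exact hc

theorem tentOn_lipschitz (c : ℝ) (b : E ⊕ R) (s s' : ℝ) :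
    |L.tentOn c b s - L.tentOn c b s'| ≤ |s - s'| := by
  have key : ∀ s s', L.tentOn c b s ≤ L.tentOn c b s' + |s - s'| := by
    intro s s'
    rw [tentOn, tentOn]
    split_ifs
    · have h1 : |s - L.s₀| ≤ |s' - L.s₀| + |s - s'| := by
        rw [add_comm]; exact abs_sub_le s s' L.s₀
      have h2 : |s' - L.s₀| ≤ |s - L.s₀| + |s - s'| := by
        rw [add_comm, abs_sub_comm s s']; exact abs_sub_le s' s L.s₀
      rw [max_add, min_add]
      exact max_le_max (by positivity) (min_le_min h1 (by linarith))
    · simp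
  rw [abs_le]
  have h1 := key s s'
  have h2 := key s' s
  rw [abs_sub_comm s' s] at h2
  constructor <;> linarith

theorem tentOn_pos {c : ℝ} {b : E ⊕ R} {s : ℝ} (h : 0 < L.tentOn c b s) :
    b = L.a ∧ L.tentOn c b s ≤ c - |s - L.s₀| := by
  rw [tentOn] at h ⊢
  split_ifs at h ⊢ with hb
  · rw [lt_max_iff] at h
    have h' := h.resolve_left (lt_irrefl _)
    rw [max_eq_right h'.le]
    exact ⟨hb, min_le_right _ _⟩
  · exact absurd h (lt_irrefl _)

variable {L L'} in
/-- The tents at two different legs are as far from each other as the sum of their heights. -/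
theorem tentOn_add_le (hne : (L.a, L.s₀) ≠ (L'.a, L'.s₀)) {c : ℝ} (hc : 2 * c ≤ L.ℓ)
    {b : E ⊕ R} {s s' : ℝ} (h : 0 < L.tentOn c b s) (h' : 0 < L'.tentOn c b s') :
    L.tentOn c b s + L'.tentOn c b s' ≤ |s - s'| := by
  obtain ⟨hb, h1⟩ := L.tentOn_pos h
  obtain ⟨hb', h2⟩ := L'.tentOn_pos h'
  have haa : L.a = L'.a := hb.symm.trans hb'
  -- Two distinct legs on one interval are the two ends of a loop, at least `ℓ ≥ 2 c` apart. Each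
  -- height is at most `c` minus the distance to its base, so the triangle inequality finishes.
  have hfar := L.far L'.s₀ v (haa ▸ L'.isEnd)
  rcases hfar with h3 | h3
  · exact absurd (Prod.ext haa h3.symm) hne
  · have t1 := abs_sub_le L'.s₀ s' L.s₀
    have t2 := abs_sub_le s' s L.s₀
    rw [abs_sub_comm L'.s₀ s'] at t1
    rw [abs_sub_comm s' s] at t2
    linarith

/-- The tent function of width `c` on the metric graph. -/
noncomputable def tent (c : ℝ) (hc : c ≤ L.ℓ) : G.Point → ℝ :=
  Quotient.lift (fun p => L.tentOn c p.1 p.2) (by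
    rintro p q (rfl | ⟨w, hp, hq⟩)
    · rfl
    · exact (L.tentOn_of_isEnd hc hp).trans (L.tentOn_of_isEnd hc hq).symm)

theorem tent_proj {c : ℝ} (hc : c ≤ L.ℓ) (b : E ⊕ R) (s : G.interval b) :
    L.tent c hc (G.proj b s) = L.tentOn c b s := rfl

theorem tent_nonneg {c : ℝ} (hc : c ≤ L.ℓ) (x : G.Point) : 0 ≤ L.tent c hc x :=
  G.forall_point (P := fun x => 0 ≤ L.tent c hc x) (fun b s => L.tentOn_nonneg c b s) x

theorem tent_le {c : ℝ} (hc : c ≤ L.ℓ) (h0 : 0 ≤ c) (x : G.Point) : L.tent c hc x ≤ c :=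
  G.forall_point (P := fun x => L.tent c hc x ≤ c) (fun b s => L.tentOn_le h0 b s) x

theorem measurable_tent {c : ℝ} (hc : c ≤ L.ℓ) : Measurable (L.tent c hc) :=
  G.measurable_of_lipschitz fun b s s' => L.tentOn_lipschitz c b s s'

variable {L L'} in
theorem tent_eq_zero_or (hne : (L.a, L.s₀) ≠ (L'.a, L'.s₀)) {c : ℝ} (hc : 2 * c ≤ L.ℓ)
    (h : c ≤ L.ℓ) (h' : c ≤ L'.ℓ) (x : G.Point) : L.tent c h x = 0 ∨ L'.tent c h' x = 0 := by
  refine G.forall_point (P := fun x => L.tent c h x = 0 ∨ L'.tent c h' x = 0) (fun b s => ?_) x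
  by_contra! hcon
  have h1 := (L.tentOn_nonneg c b s).lt_of_ne' hcon.1
  have h2 := (L'.tentOn_nonneg c b s).lt_of_ne' hcon.2
  have := tentOn_add_le hne hc h1 h2
  rw [sub_self, abs_zero] at this
  linarith

/-- The point of the leg at distance `u` from the vertex. -/
noncomputable def point (u : ℝ) : G.Point := G.proj L.a (G.toInterval L.a (L.s₀ + L.σ * u))

theorem measurable_point : Measurable L.point :=
  (G.measurable_proj L.a).comp ((G.continuous_toInterval L.a).comp (by fun_prop)).measurable

theorem point_eq {u : ℝ} (hu : u ∈ Icc 0 L.ℓ) : L.point u = G.proj L.a ⟨_, L.mem u hu⟩ := by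
  rw [point, G.toInterval_of_mem]

theorem point_zero_eq : L.point 0 = L'.point 0 := by
  rw [L.point_eq ⟨le_rfl, L.pos.le⟩, L'.point_eq ⟨le_rfl, L'.pos.le⟩]
  refine Quotient.sound (Or.inr ⟨v, ?_, ?_⟩)
  · simpa using L.isEnd
  · simpa using L'.isEnd

theorem edist_point_zero {u : ℝ} (hu : u ∈ Icc 0 L.ℓ) :
    edist (L.point u) (L.point 0) ≤ ENNReal.ofReal u := by
  rw [L.point_eq hu, L.point_eq ⟨le_rfl, L.pos.le⟩]
  refine (G.edist_proj_le _ _ _).trans_eq ?_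
  rw [Subtype.edist_eq, edist_dist, Real.dist_eq]
  simp [abs_mul, L.abs_σ, abs_of_nonneg hu.1]

/-- Going through the vertex gives the upper bound; the lower bounds needed for the argument come
from the height functions. -/
theorem edist_point_le {u u' : ℝ} (hu : u ∈ Icc 0 L.ℓ) (hu' : u' ∈ Icc 0 L'.ℓ) :
    edist (L.point u) (L'.point u') ≤ ENNReal.ofReal (u + u') := by
  rw [ENNReal.ofReal_add hu.1 hu'.1]
  refine (edist_triangle _ (L.point 0) _).trans (add_le_add (L.edist_point_zero hu) ?_)
  rw [L.point_zero_eq L', edist_comm]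
  exact L'.edist_point_zero hu'

theorem tent_point {c : ℝ} (hc : c ≤ L.ℓ) {u : ℝ} (h0 : 0 ≤ u) (hu : 2 * u ≤ c) :
    L.tent c hc (L.point u) = u := by
  rw [L.point_eq ⟨h0, by linarith⟩, tent_proj, tentOn, if_pos rfl]
  have : |L.s₀ + L.σ * u - L.s₀| = u := by
    rw [add_sub_cancel_left, abs_mul, L.abs_σ, abs_of_nonneg h0, one_mul]
  rw [this, min_eq_left (by linarith), max_eq_right h0]

/-- The part of the leg at distance between `p` and `q` from the vertex, cut out by two tent
functions. -/
noncomputable def segment (c : ℝ) (hc : 2 * c ≤ L.ℓ) (hc' : c ≤ L.ℓ) (p q : ℝ) : Set G.Point :=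
  {x | L.tent c hc' x ∈ Icc p q ∧ L.tent (2 * c) hc x ∈ Icc p q}

/-! ### Segments of a leg and their measure -/

section Segment

variable {c : ℝ} (hc : 2 * c ≤ L.ℓ) (hc' : c ≤ L.ℓ) {p q : ℝ}

theorem measurableSet_segment : MeasurableSet (L.segment c hc hc' p q) :=
  (L.measurable_tent hc' measurableSet_Icc).inter (L.measurable_tent hc measurableSet_Icc)

/-- Positivity of the narrow tent forces the distance from the base below `c`; there the wide tent
has value at most `q < c` only on its ascending side. This removes the spurious far part of the
level set. -/
theorem proj_mem_segment (hp : 0 < p) (hq : 2 * q < c) (b : E ⊕ R) (s : G.interval b) :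
    G.proj b s ∈ L.segment c hc hc' p q ↔ b = L.a ∧ |(s : ℝ) - L.s₀| ∈ Icc p q := by
  change L.tentOn c b s ∈ Icc p q ∧ L.tentOn (2 * c) b s ∈ Icc p q ↔ _
  rw [tentOn, tentOn]
  split_ifs with hb
  · set d := |(s : ℝ) - L.s₀|
    simp only [hb, true_and]
    constructor
    · rintro ⟨⟨h1, h2⟩, h3, h4⟩
      have h1' := (le_max_iff.1 h1).resolve_left hp.not_ge
      have h3' := (le_max_iff.1 h3).resolve_left hp.not_ge
      rw [le_min_iff] at h1' h3'
      refine ⟨h1'.1, ?_⟩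
      rcases min_le_iff.1 (max_le_iff.1 h4).2 with h | h <;>
      rcases min_le_iff.1 (max_le_iff.1 h2).2 with h' | h' <;> linarith
    · rintro ⟨h1, h2⟩
      rw [min_eq_left (by linarith), min_eq_left (by linarith), max_eq_right (by linarith)]
      exact ⟨⟨h1, h2⟩, h1, h2⟩
  · simp [hb, hp]

theorem exists_of_mem_segment (hp : 0 < p) (hq : 2 * q < c) {x : G.Point}
    (hx : x ∈ L.segment c hc hc' p q) : ∃ u ∈ Icc p q, x = L.point u := by
  refine G.forall_point (P := fun x => x ∈ L.segment c hc hc' p q → ∃ u ∈ Icc p q, x = L.point u)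
    (fun b s h => ?_) x hx
  obtain ⟨rfl, hs⟩ := (L.proj_mem_segment hc hc' hp hq b s).1 h
  refine ⟨|(s : ℝ) - L.s₀|, hs, ?_⟩
  rw [point, ← L.eq s s.2, G.toInterval_of_mem s.2]

theorem measurePreserving_coord : MeasurePreserving (fun x : ℝ => L.σ * (x - L.s₀)) := by
  rcases L.sign with h | h
  · simpa [h] using measurePreserving_sub_right volume L.s₀
  · simpa [h] using Measure.measurePreserving_sub_left volume L.s₀

/-- Only the interval of the leg meets the segment, and there the coordinate `σ (s - s₀)`, inverse
to the parametrization since `σ² = 1`, preserves Lebesgue measure. -/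
theorem measure_restrict_segment (hp : 0 < p) (hq : 2 * q < c) :
    G.measure.restrict (L.segment c hc hc' p q) = (volume.restrict (Icc p q)).map L.point := by
  ext M hM
  have hS : MeasurableSet (L.segment c hc hc' p q) := L.measurableSet_segment hc hc'
  rw [Measure.restrict_apply hM, Measure.map_apply L.measurable_point hM,
    Measure.restrict_apply (L.measurable_point hM), G.measure_apply (hM.inter hS),
    tsum_eq_single L.a]
  · rw [← L.measurePreserving_coord.measure_preimage (s := L.point ⁻¹' M ∩ Icc p q)
      ((L.measurable_point hM).inter measurableSet_Icc).nullMeasurableSet]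
    congr 1
    ext x
    constructor
    · rintro ⟨s, ⟨hsM, hsS⟩, rfl⟩
      have hs := ((L.proj_mem_segment hc hc' hp hq _ s).1 hsS).2
      have e : L.σ * ((s : ℝ) - L.s₀) = |(s : ℝ) - L.s₀| := by
        conv_lhs => rw [L.eq s s.2]
        rw [add_sub_cancel_left, ← mul_assoc, L.σ_mul_σ, one_mul]
      change L.σ * ((s : ℝ) - L.s₀) ∈ L.point ⁻¹' M ∩ Icc p q
      rw [e]
      refine ⟨?_, hs⟩
      change L.point _ ∈ M
      rw [point, ← L.eq s s.2, G.toInterval_of_mem s.2]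
      exact hsM
    · rintro ⟨hxM, hxu⟩
      have hx : L.s₀ + L.σ * (L.σ * (x - L.s₀)) = x := by
        rw [← mul_assoc, L.σ_mul_σ]; ring
      have hpq : L.σ * (x - L.s₀) ∈ Icc 0 L.ℓ :=
        ⟨hp.le.trans hxu.1, by linarith [hxu.1, hxu.2]⟩
      have hmem := L.mem _ hpq
      change L.point (L.σ * (x - L.s₀)) ∈ M at hxM
      rw [L.point_eq hpq] at hxM
      simp only [hx] at hmem hxM
      refine ⟨⟨x, hmem⟩, ⟨hxM, (L.proj_mem_segment hc hc' hp hq _ _).2 ⟨rfl, ?_⟩⟩, rfl⟩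
      have e : |x - L.s₀| = L.σ * (x - L.s₀) := by
        rw [← abs_of_nonneg hpq.1, abs_mul, L.abs_σ, one_mul]
      simpa only [e] using hxu
  · intro b hb
    have : G.proj b ⁻¹' (M ∩ L.segment c hc hc' p q) = ∅ :=
      eq_empty_of_forall_notMem fun s hs =>
        hb ((L.proj_mem_segment hc hc' hp hq b s).1 hs.2).1
    rw [this]
    simp

theorem measure_segment (hp : 0 < p) (hq : 2 * q < c) :
    G.measure (L.segment c hc hc' p q) = ENNReal.ofReal (q - p) := by
  rw [← Measure.restrict_apply_univ, L.measure_restrict_segment hc hc' hp hq,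
    Measure.map_apply L.measurable_point .univ]
  simp

end Segment

/-- The signed distance from the vertex near the three legs. -/
noncomputable def height (L₁ L₂ L₃ : G.Leg v) (c : ℝ) (h₁ : c ≤ L₁.ℓ) (h₂ : c ≤ L₂.ℓ) (h₃ : c ≤ L₃.ℓ)
    (x : G.Point) : ℝ :=
  L₁.tent c h₁ x - max (L₂.tent c h₂ x) (L₃.tent c h₃ x)

/-! ### The signed height as a global Lipschitz function -/

section Height

variable {L₁ L₂ L₃ : G.Leg v} (h12 : (L₁.a, L₁.s₀) ≠ (L₂.a, L₂.s₀))
  (h13 : (L₁.a, L₁.s₀) ≠ (L₃.a, L₃.s₀)) (h23 : (L₂.a, L₂.s₀) ≠ (L₃.a, L₃.s₀))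
  {c : ℝ} (hc₁ : 2 * c ≤ L₁.ℓ) (hc₂ : 2 * c ≤ L₂.ℓ)
  (h₁ : c ≤ L₁.ℓ) (h₂ : c ≤ L₂.ℓ) (h₃ : c ≤ L₃.ℓ)

-- On one interval the only dangerous case is a positive first tent at one point and a positive
-- second or third tent at the other, where heights add up; `tentOn_add_le` covers it. The maximum
-- makes separation of the second and third legs unnecessary here.
include h12 h13 hc₁ in
theorem height_lipschitz (x y : G.Point) :
    ENNReal.ofReal |height L₁ L₂ L₃ c h₁ h₂ h₃ x - height L₁ L₂ L₃ c h₁ h₂ h₃ y| ≤ edist x y := by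
  refine G.ofReal_abs_sub_le_edist (fun b s s' => ?_) x y
  have key : ∀ s s' : G.interval b, height L₁ L₂ L₃ c h₁ h₂ h₃ (G.proj b s)
      - height L₁ L₂ L₃ c h₁ h₂ h₃ (G.proj b s') ≤ |(s : ℝ) - s'| := by
    intro s s'
    simp only [height, tent_proj]
    have l1 := (abs_le.1 (L₁.tentOn_lipschitz c b s s')).2
    have l2 := (abs_le.1 (L₂.tentOn_lipschitz c b s s')).1
    have l3 := (abs_le.1 (L₃.tentOn_lipschitz c b s s')).1
    have m2 := le_max_left (L₂.tentOn c b s) (L₃.tentOn c b s)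
    have m3 := le_max_right (L₂.tentOn c b s) (L₃.tentOn c b s)
    have n1 := L₁.tentOn_nonneg c b s
    have n1' := L₁.tentOn_nonneg c b s'
    have n2 := L₂.tentOn_nonneg c b s
    have n2' := L₂.tentOn_nonneg c b s'
    have n3' := L₃.tentOn_nonneg c b s'
    rcases n1.eq_or_lt with e | p1
    · rcases max_choice (L₂.tentOn c b s') (L₃.tentOn c b s') with h | h <;> rw [h] <;> linarith
    · rcases max_choice (L₂.tentOn c b s') (L₃.tentOn c b s') with h | h <;> rw [h]
      · rcases n2'.eq_or_lt with e | p2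
        · linarith
        · linarith [tentOn_add_le h12 hc₁ p1 p2]
      · rcases n3'.eq_or_lt with e | p3
        · linarith
        · linarith [tentOn_add_le h13 hc₁ p1 p3]
  have k1 := key s s'
  have k2 := key s' s
  rw [abs_sub_comm (s' : ℝ)] at k2
  rw [abs_le]
  constructor <;> linarith

theorem abs_height_le (h0 : 0 ≤ c) (x : G.Point) : |height L₁ L₂ L₃ c h₁ h₂ h₃ x| ≤ c := by
  have := L₁.tent_nonneg h₁ x
  have := L₁.tent_le h₁ h0 x
  have := L₂.tent_nonneg h₂ x
  have := le_max_left (L₂.tent c h₂ x) (L₃.tent c h₃ x)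
  have := max_le (L₂.tent_le h₂ h0 x) (L₃.tent_le h₃ h0 x)
  rw [height, abs_le]
  constructor <;> linarith

include h12 h13 hc₁ in
theorem height_eq_of_pos_left {x : G.Point} (hx : 0 < L₁.tent c h₁ x) :
    height L₁ L₂ L₃ c h₁ h₂ h₃ x = L₁.tent c h₁ x := by
  rw [height, (tent_eq_zero_or h12 hc₁ h₁ h₂ x).resolve_left hx.ne',
    (tent_eq_zero_or h13 hc₁ h₁ h₃ x).resolve_left hx.ne', max_self, sub_zero]

include h12 h13 hc₁ in
theorem height_eq_of_pos {x : G.Point} (hx : 0 < height L₁ L₂ L₃ c h₁ h₂ h₃ x) :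
    height L₁ L₂ L₃ c h₁ h₂ h₃ x = L₁.tent c h₁ x := by
  refine height_eq_of_pos_left h12 h13 hc₁ h₁ h₂ h₃ ?_
  rw [height] at hx
  linarith [L₂.tent_nonneg h₂ x, le_max_left (L₂.tent c h₂ x) (L₃.tent c h₃ x)]

include h12 h23 hc₁ hc₂ in
theorem height_eq_of_pos_middle {x : G.Point} (hx : 0 < L₂.tent c h₂ x) :
    height L₁ L₂ L₃ c h₁ h₂ h₃ x = -L₂.tent c h₂ x := by
  rw [height, (tent_eq_zero_or h12 hc₁ h₁ h₂ x).resolve_right hx.ne',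
    (tent_eq_zero_or h23 hc₂ h₂ h₃ x).resolve_left hx.ne', max_eq_left hx.le, zero_sub]

theorem height_swap (x : G.Point) :
    height L₁ L₂ L₃ c h₁ h₂ h₃ x = height L₁ L₃ L₂ c h₁ h₃ h₂ x := by
  rw [height, height, max_comm]

end Height

end Leg

end MetricGraph


/-! ### The branching configuration at a vertex -/

namespace MetricGraph

variable {V E R : Type*} (G : MetricGraph V E R)

/-- A vertex of degree greater than two has three different legs. -/
theorem exists_three_legs [Finite E] [Finite R] {v : V} (hv : 2 < G.degree v) :
    ∃ L₁ L₂ L₃ : G.Leg v, (L₁.a, L₁.s₀) ≠ (L₂.a, L₂.s₀) ∧ (L₁.a, L₁.s₀) ≠ (L₃.a, L₃.s₀) ∧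
      (L₂.a, L₂.s₀) ≠ (L₃.a, L₃.s₀) := by
  let T := ({e // G.source e = v} ⊕ {e // G.target e = v}) ⊕ {r // G.root r = v}
  let φ : T → (E ⊕ R) × ℝ := Sum.elim
    (Sum.elim (fun e => (.inl e.1, 0)) (fun e => (.inl e.1, G.length e))) (fun r => (.inr r.1, 0))
  -- Positive lengths separate the two ends of a loop, so a loop contributes two legs, as in the
  -- degree.
  have hφ : Function.Injective φ := by
    rintro ((⟨e, he⟩ | ⟨e, he⟩) | ⟨r, hr⟩) ((⟨e', he'⟩ | ⟨e', he'⟩) | ⟨r', hr'⟩) h <;>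
      simp only [φ, Sum.elim_inl, Sum.elim_inr, Prod.mk.injEq, Sum.inl.injEq, Sum.inr.injEq,
        reduceCtorEq, false_and] at h
    · obtain ⟨rfl, -⟩ := h; rfl
    · exact absurd h.2 (G.length_pos e').ne
    · exact absurd h.2 (G.length_pos e).ne'
    · obtain ⟨rfl, -⟩ := h; rfl
    · obtain ⟨rfl, -⟩ := h; rfl
  have hend : ∀ x : T, G.IsEnd (φ x).1 (φ x).2 v := by
    rintro ((⟨e, he⟩ | ⟨e, he⟩) | ⟨r, hr⟩)
    exacts [.inl ⟨rfl, he⟩, .inr ⟨rfl, he⟩, ⟨rfl, hr⟩]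
  have hcard : 2 < Nat.card T := by
    rw [Nat.card_sum, Nat.card_sum]
    exact hv
  have := Fintype.ofFinite T
  rw [Nat.card_eq_fintype_card] at hcard
  obtain ⟨x, y, z, hxy, hxz, hyz⟩ := Fintype.two_lt_card_iff.1 hcard
  choose L ha hs using fun x => G.exists_leg (hend x)
  have hL : ∀ x, ((L x).a, (L x).s₀) = φ x := fun x => Prod.ext (ha x) (hs x)
  refine ⟨L x, L y, L z, ?_, ?_, ?_⟩ <;> rw [hL, hL] <;> exact hφ.ne ‹_›

theorem map_restrict_add {X : Type*} [MeasurableSpace X] {g : ℝ → X} (hg : Measurable g)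
    (p ε : ℝ) : (volume.restrict (Icc p (p + ε))).map g
      = (volume.restrict (Icc 0 ε)).map fun t => g (p + t) := by
  have h := (measurePreserving_add_left volume p).restrict_preimage
    (measurableSet_Icc (a := p) (b := p + ε))
  rw [← h.map_eq, Measure.map_map hg (by fun_prop)]
  simp [Function.comp_def]

theorem map_restrict_sub {X : Type*} [MeasurableSpace X] {g : ℝ → X} (hg : Measurable g)
    (q ε : ℝ) : (volume.restrict (Icc (q - ε) q)).map g
      = (volume.restrict (Icc 0 ε)).map fun t => g (q - t) := by
  have h := (Measure.measurePreserving_sub_left volume q).restrict_preimage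
    (measurableSet_Icc (a := q - ε) (b := q))
  rw [← h.map_eq, Measure.map_map hg (by fun_prop)]
  simp [Function.comp_def]

/-- Three legs at a vertex give a branching configuration of every sufficiently small size. -/
noncomputable def branchingConfig {v : V} {L₁ L₂ L₃ : G.Leg v} (h12 : (L₁.a, L₁.s₀) ≠ (L₂.a, L₂.s₀))
    (h13 : (L₁.a, L₁.s₀) ≠ (L₃.a, L₃.s₀)) (h23 : (L₂.a, L₂.s₀) ≠ (L₃.a, L₃.s₀))
    {ε : ℝ} (hε : 0 < ε) (h₁ : 80 * ε ≤ L₁.ℓ) (h₂ : 80 * ε ≤ L₂.ℓ) (h₃ : 80 * ε ≤ L₃.ℓ) :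
    BranchingConfig G.measure Bool ε (7 * ε) (5 * ε) :=
  -- Heights run from `[5 ε, 6 ε]` to `[-2 ε, -ε]`, with midpoints in `[3 ε / 2, 5 ε / 2]`, still
  -- strictly above the vertex. The narrow width `20 ε` exceeds twice the largest distance `6 ε`;
  -- the wide one is `40 ε`, and its Lipschitz bound needs legs of length `80 ε`.
  have d₁ : 2 * (20 * ε) ≤ L₁.ℓ := by linarith
  have d₂ : 2 * (20 * ε) ≤ L₂.ℓ := by linarith
  have d₃ : 2 * (20 * ε) ≤ L₃.ℓ := by linarith
  have e₁ : 20 * ε ≤ L₁.ℓ := by linarith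
  have e₂ : 20 * ε ≤ L₂.ℓ := by linarith
  have e₃ : 20 * ε ≤ L₃.ℓ := by linarith
  have dd₁ : 2 * (2 * (20 * ε)) ≤ L₁.ℓ := by linarith
  have dd₂ : 2 * (2 * (20 * ε)) ≤ L₂.ℓ := by linarith
  have dd₃ : 2 * (2 * (20 * ε)) ≤ L₃.ℓ := by linarith
  { A := L₁.segment (20 * ε) d₁ e₁ (5 * ε) (5 * ε + ε)
    B := L₂.segment (20 * ε) d₂ e₂ (2 * ε - ε) (2 * ε) ∪
      L₃.segment (20 * ε) d₃ e₃ (2 * ε - ε) (2 * ε)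
    α := fun t => L₁.point (5 * ε + t)
    -- The parameter is reversed so that `(5 ε + t) + (2 ε - t)` is constant.
    β := fun t => L₂.point (2 * ε - t)
    γ := fun t => L₃.point (2 * ε - t)
    f := fun i => match i with
      | false => Leg.height L₁ L₂ L₃ (20 * ε) e₁ e₂ e₃
      | true => Leg.height L₁ L₂ L₃ (2 * (20 * ε)) d₁ d₂ d₃
    pos := hε
    le := by linarith
    measurable_A := L₁.measurableSet_segment d₁ e₁
    measurable_B := (L₂.measurableSet_segment d₂ e₂).union (L₃.measurableSet_segment d₃ e₃)
    measurable_α := L₁.measurable_point.comp (by fun_prop)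
    measurable_β := L₂.measurable_point.comp (by fun_prop)
    measurable_γ := L₃.measurable_point.comp (by fun_prop)
    restrict_A := by
      rw [L₁.measure_restrict_segment d₁ e₁ (by linarith) (by linarith),
        map_restrict_add L₁.measurable_point]
    restrict_B := by
      have hdisj : Disjoint (L₂.segment (20 * ε) d₂ e₂ (2 * ε - ε) (2 * ε))
          (L₃.segment (20 * ε) d₃ e₃ (2 * ε - ε) (2 * ε)) := by
        refine Set.disjoint_left.2 fun x h h' => ?_
        rcases Leg.tent_eq_zero_or h23 d₂ e₂ e₃ x with h0 | h0
        · linarith [h.1.1]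
        · linarith [h'.1.1]
      rw [Measure.restrict_union hdisj (L₃.measurableSet_segment d₃ e₃),
        L₂.measure_restrict_segment d₂ e₂ (by linarith) (by linarith),
        L₃.measure_restrict_segment d₃ e₃ (by linarith) (by linarith),
        map_restrict_sub L₂.measurable_point, map_restrict_sub L₃.measurable_point]
    exists_A := fun x hx => by
      obtain ⟨u, hu, rfl⟩ := L₁.exists_of_mem_segment d₁ e₁ (by linarith) (by linarith) hx
      exact ⟨u - 5 * ε, ⟨by linarith [hu.1], by linarith [hu.2]⟩, by rw [add_sub_cancel]⟩
    exists_B := fun x hx => by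
      rcases hx with hx | hx
      · obtain ⟨u, hu, rfl⟩ := L₂.exists_of_mem_segment d₂ e₂ (by linarith) (by linarith) hx
        exact ⟨2 * ε - u, ⟨by linarith [hu.2], by linarith [hu.1]⟩, .inl (by rw [sub_sub_cancel])⟩
      · obtain ⟨u, hu, rfl⟩ := L₃.exists_of_mem_segment d₃ e₃ (by linarith) (by linarith) hx
        exact ⟨2 * ε - u, ⟨by linarith [hu.2], by linarith [hu.1]⟩, .inr (by rw [sub_sub_cancel])⟩
    edist_β := fun s hs t ht => by
      obtain ⟨⟨hs0, hs1⟩, ht0, ht1⟩ := And.intro hs ht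
      refine (L₁.edist_point_le L₂ ⟨by linarith, by linarith⟩ ⟨by linarith, by linarith⟩).trans_eq ?_
      congr 1
      ring
    edist_γ := fun s hs t ht => by
      obtain ⟨⟨hs0, hs1⟩, ht0, ht1⟩ := And.intro hs ht
      refine (L₁.edist_point_le L₃ ⟨by linarith, by linarith⟩ ⟨by linarith, by linarith⟩).trans_eq ?_
      congr 1
      ring
    lipschitz := Bool.forall_bool.2
      ⟨Leg.height_lipschitz h12 h13 d₁ e₁ e₂ e₃, Leg.height_lipschitz h12 h13 dd₁ d₁ d₂ d₃⟩
    bounded := Bool.forall_bool.2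
      ⟨⟨_, Leg.abs_height_le e₁ e₂ e₃ (by positivity)⟩,
        ⟨_, Leg.abs_height_le d₁ d₂ d₃ (by positivity)⟩⟩
    f_α := by
      have key : ∀ (c : ℝ) (k₁ : c ≤ L₁.ℓ) (k₂ : c ≤ L₂.ℓ) (k₃ : c ≤ L₃.ℓ), 2 * c ≤ L₁.ℓ →
          20 * ε ≤ c → ∀ t ∈ Icc 0 ε,
          Leg.height L₁ L₂ L₃ c k₁ k₂ k₃ (L₁.point (5 * ε + t)) = 5 * ε + t := by
        intro c k₁ k₂ k₃ hc hcε t ht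
        obtain ⟨ht0, ht1⟩ := ht
        have ht := L₁.tent_point k₁ (u := 5 * ε + t) (by linarith) (by linarith)
        rw [Leg.height_eq_of_pos_left h12 h13 hc k₁ k₂ k₃ (by rw [ht]; linarith), ht]
      exact Bool.forall_bool.2
        ⟨key _ e₁ e₂ e₃ d₁ le_rfl, key _ d₁ d₂ d₃ dd₁ (by linarith)⟩
    f_β := by
      have key : ∀ (c : ℝ) (k₁ : c ≤ L₁.ℓ) (k₂ : c ≤ L₂.ℓ) (k₃ : c ≤ L₃.ℓ), 2 * c ≤ L₁.ℓ →
          2 * c ≤ L₂.ℓ → 20 * ε ≤ c → ∀ t ∈ Icc 0 ε,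
          Leg.height L₁ L₂ L₃ c k₁ k₂ k₃ (L₂.point (2 * ε - t)) = 5 * ε - 7 * ε + t := by
        intro c k₁ k₂ k₃ hc hc' hcε t ht
        obtain ⟨ht0, ht1⟩ := ht
        have ht := L₂.tent_point k₂ (u := 2 * ε - t) (by linarith) (by linarith)
        rw [Leg.height_eq_of_pos_middle h12 h23 hc hc' k₁ k₂ k₃ (by rw [ht]; linarith), ht]
        ring
      exact Bool.forall_bool.2
        ⟨key _ e₁ e₂ e₃ d₁ d₂ le_rfl, key _ d₁ d₂ d₃ dd₁ dd₂ (by linarith)⟩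
    f_γ := by
      have key : ∀ (c : ℝ) (k₁ : c ≤ L₁.ℓ) (k₂ : c ≤ L₂.ℓ) (k₃ : c ≤ L₃.ℓ), 2 * c ≤ L₁.ℓ →
          2 * c ≤ L₃.ℓ → 20 * ε ≤ c → ∀ t ∈ Icc 0 ε,
          Leg.height L₁ L₂ L₃ c k₁ k₂ k₃ (L₃.point (2 * ε - t)) = 5 * ε - 7 * ε + t := by
        intro c k₁ k₂ k₃ hc hc' hcε t ht
        obtain ⟨ht0, ht1⟩ := ht
        have ht := L₃.tent_point k₃ (u := 2 * ε - t) (by linarith) (by linarith)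
        rw [Leg.height_swap, Leg.height_eq_of_pos_middle h13 h23.symm hc hc' k₁ k₃ k₂
          (by rw [ht]; linarith), ht]
        ring
      exact Bool.forall_bool.2
        ⟨key _ e₁ e₂ e₃ d₁ d₃ le_rfl, key _ d₁ d₂ d₃ dd₁ dd₃ (by linarith)⟩
    measure_le := by
      have hm := L₁.measure_segment d₁ e₁ (p := 5 * ε - 7 * ε / 2) (q := 5 * ε + ε - 7 * ε / 2)
        (by linarith) (by linarith)
      rw [show 5 * ε + ε - 7 * ε / 2 - (5 * ε - 7 * ε / 2) = ε by ring] at hm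
      rw [← hm]
      refine measure_mono fun x hx => ?_
      have hx0 := hx false
      have hx1 := hx true
      simp only at hx0 hx1
      -- Positive height means lying under the first tent, so the bounds on the two heights are the
      -- two conditions that define the segment.
      have p0 := Leg.height_eq_of_pos h12 h13 d₁ e₁ e₂ e₃ (x := x) (by linarith [hx0.1])
      have p1 := Leg.height_eq_of_pos h12 h13 dd₁ d₁ d₂ d₃ (x := x) (by linarith [hx1.1])
      rw [p0] at hx0
      rw [p1] at hx1
      exact ⟨hx0, hx1⟩ }

end MetricGraph

theorem mainTheorem12 {V E R : Type*} [Finite E] [Finite R] (G : MetricGraph V E R)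
    (hG : ∃ v : V, 2 < G.degree v) (K : ℝ) :
    (∃ (A B : Set G.Point) (t : ℝ), MeasurableSet A ∧ MeasurableSet B ∧
      0 < G.measure A ∧ G.measure A < ∞ ∧ 0 < G.measure B ∧ G.measure B < ∞ ∧
      Metric.ediam (A ∪ B) < ∞ ∧ 0 < t ∧ t < 1 ∧
      ¬ BrunnMinkowski G.measure K A B t) ∧
    ¬ CDInfty G.measure K := by
  obtain ⟨v, hv⟩ := hG
  obtain ⟨L₁, L₂, L₃, h12, h13, h23⟩ := G.exists_three_legs hv
  have hlog : 0 < Real.log 2 / 2 := half_pos (Real.log_pos one_lt_two)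
  -- All requirements on `ε > 0` are strict inequalities between continuous functions that hold at
  -- `0`, so one small `ε` meets them all.
  have hsmall : ∀ᶠ ε in nhdsWithin (0 : ℝ) (Ioi 0), 0 < ε ∧ 80 * ε < L₁.ℓ ∧ 80 * ε < L₂.ℓ ∧
      80 * ε < L₃.ℓ ∧ |K| * (7 * ε) ^ 2 / 8 < Real.log 2 / 2 := by
    have lim : ∀ (g : ℝ → ℝ) (b : ℝ), Continuous g → g 0 < b →
        ∀ᶠ ε in nhdsWithin (0 : ℝ) (Ioi 0), g ε < b := fun g b hg hb =>
      (hg.continuousAt.eventually (gt_mem_nhds hb)).filter_mono nhdsWithin_le_nhds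
    filter_upwards [self_mem_nhdsWithin,
      lim (fun ε => 80 * ε) _ (by fun_prop) (by simpa using L₁.pos),
      lim (fun ε => 80 * ε) _ (by fun_prop) (by simpa using L₂.pos),
      lim (fun ε => 80 * ε) _ (by fun_prop) (by simpa using L₃.pos),
      lim (fun ε => |K| * (7 * ε) ^ 2 / 8) (Real.log 2 / 2) (by fun_prop) (by simpa using hlog)]
      with ε a0 a1 a2 a3 a4 using ⟨a0, a1, a2, a3, a4⟩
  obtain ⟨ε, hε, h₁, h₂, h₃, hK⟩ := hsmall.exists
  let c := G.branchingConfig h12 h13 h23 hε h₁.le h₂.le h₃.le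
  exact ⟨⟨c.A, c.B, 1 / 2, c.measurable_A, c.measurable_B, pos_iff_ne_zero.2 c.measure_A_ne_zero,
    c.measure_A_ne_top.lt_top, pos_iff_ne_zero.2 c.measure_B_ne_zero, c.measure_B_ne_top.lt_top,
    c.ediam_lt_top, by norm_num, by norm_num, c.not_brunnMinkowski hK⟩, c.not_cdInfty hK⟩
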